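/- Let $n\ge 1$. Let $X,Z,H$ be the usual Pauli and Hadamard $2\times 2$ matrices, let $\mathcal P_n\subset U(2^n)$ be the $n$-qubit Pauli group (all $n$-fold tensor products of elements of $\langle X,Z,iI_2\rangle$), let $\mathrm{Cliff}(n)$ be its normalizer in $U(2^n)$, and let $\mathcal C_n=\mathrm{Cliff}(n)/U(1)$ be the projective Clifford group, in which $[U]$ denotes the class of $U$. Let $\widetilde{\mathcal P}_n\cong\mathbb Z_2^{2n}$ be the image of $\mathcal P_n$ in $\mathcal C_n$, a normal subgroup. A subscript $j$ on a one-qubit gate means that it acts on the $j$-th qubit. Let $\sigma_1$ be the character of $\widetilde{\mathcal P}_n$ with $\sigma_1([X_1])=\sigma_1([Z_1])=-1$ and $\sigma_1([X_j])=\sigma_1([Z_j])=1$ for $j\ge 2$. Let $$IN_n=\langle [M],\,[H_1],\,[X_1],\,[I\otimes A] : A\in \mathrm{Cliff}(n-1)\rangle\le\mathcal C_n,\qquad M=CX_{1,2}\,(Z_1H_1X_2)\,CX_{1,2},$$ where the generator $[M]$ is omitted if $n=1$. **Theorem.** $IN_n$ is the inertia group $\{g\in\mathcal C_n: {}^g\sigma_1\sim\sigma_1\}$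 of $\sigma_1$, and $\sigma_1$ extends to a one-dimensional complex representation of $IN_n$. There is an isomorphism $\mathcal C_n/\widetilde{\mathcal P}_n\cong Sp(2n,2)$ under which the class of $U$ corresponds to the matrix $\Gamma$ with $UW_xU^{-1}\in\mathbb C\,W_{\Gamma x}$ for all $x=(p,q)\in\mathbb Z_2^{2n}$, where $W_{(p,q)}=Z^{p_1}X^{q_1}\otimes\cdots\otimes Z^{p_n}X^{q_n}$. Let $\sigma_1'$ be any extension of $\sigma_1$ to $IN_n$. Then, up to equivalence, the irreducible complex representations of $\mathcal C_n$ are $$\widehat{\mathcal C_n}=\left\{\mathrm{Ind}_{IN_n}^{\mathcal C_n}(\sigma_1'\otimes\widetilde\psi):\psi\in\widehat{IN_n/\widetilde{\mathcal P}_n}\right\}\cup\left\{\widetilde\psi:\psi\in\widehat{Sp(2n,2)}\right\},$$ where $\widetilde\psi$ is the inflation of $\psi$ to $IN_n$ in the first set and, through the above isomorphism, to $\mathcal C_n$ in the second. That is, all representations in this list are irreducible, every irreducible representation of $\mathcal C_n$ is equivalent to one in the list, and the list has no repetitions: inequivalent $\psi$ within one set give inequivalent representations, and no representation in the first set is equivalent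 to one in the second. -/

import Mathlib

open scoped Matrix

universe u

/-! ### Clifford theory: conjugation, inertia groups, extensions, inflation -/

section CliffordTheory

variable {G : Type*} [Group G]

/-- A linear character, viewed as a representation on the one-dimensional space `ℂ`. -/
noncomputable def charRep (χ : G →* ℂˣ) : Representation ℂ G ℂ where
  toFun g := ((χ g : ℂˣ) : ℂ) • LinearMap.id
  map_one' := by simp [Module.End.one_eq_id]
  map_mul' g h := by
    ext
    simp [mul_comm]

variable {N : Subgroup G} [N.Normal] {V : Type*} [AddCommGroup V] [Module ℂ V]

/-- The `g`-conjugate `n ↦ σ (g⁻¹ n g)` of a representation `σ` of a normal subgroup. -/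
noncomputable def conjRep (g : G) (σ : Representation ℂ N V) : Representation ℂ N V :=
  MonoidHom.comp σ (MulAut.conjNormal g⁻¹ : N ≃* N).toMonoidHom

theorem conjRep_apply (g : G) (σ : Representation ℂ N V) (x : N) :
    conjRep g σ x = σ (MulAut.conjNormal g⁻¹ x) := rfl

theorem conjRep_one (σ : Representation ℂ N V) : conjRep 1 σ = σ := by
  ext x v
  simp [conjRep_apply]

theorem conjRep_mul (g h : G) (σ : Representation ℂ N V) :
    conjRep (g * h) σ = conjRep g (conjRep h σ) := by
  ext x v
  simp [conjRep_apply]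

/-- Conjugation by `g` respects equivalence of representations. -/
theorem conjRep_equiv (g : G) {σ τ : Representation ℂ N V} (e : σ.Equiv τ) :
    Nonempty ((conjRep g σ).Equiv (conjRep g τ)) :=
  ⟨Representation.Equiv.mk e.toLinearEquiv fun x => e.isIntertwining' (MulAut.conjNormal g⁻¹ x)⟩

/-- The inertia group `{g ∈ G : ᵍσ ∼ σ}` of a representation `σ` of a normal subgroup of `G`. -/
def inertia (σ : Representation ℂ N V) : Subgroup G where
  carrier := {g | Nonempty ((conjRep g σ).Equiv σ)}
  one_mem' := by
    show Nonempty ((conjRep 1 σ).Equiv σ)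
    rw [conjRep_one]
    exact ⟨Representation.Equiv.refl σ⟩
  mul_mem' := by
    rintro g h ⟨a⟩ ⟨b⟩
    show Nonempty ((conjRep (g * h) σ).Equiv σ)
    rw [conjRep_mul]
    obtain ⟨c⟩ := conjRep_equiv g b
    exact ⟨c.trans a⟩
  inv_mem' := by
    rintro g ⟨a⟩
    show Nonempty ((conjRep g⁻¹ σ).Equiv σ)
    obtain ⟨c⟩ := conjRep_equiv g⁻¹ a
    rw [← conjRep_mul, inv_mul_cancel, conjRep_one] at c
    exact ⟨c.symm⟩

/-- `σ'` is a representation of a subgroup `H ≥ N` whose restriction to `N` is `σ`. -/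
def IsExtension (σ : Representation ℂ N V) {H : Subgroup G} (σ' : Representation ℂ H V) : Prop :=
  ∃ h : N ≤ H, MonoidHom.comp σ' (Subgroup.inclusion h) = σ

/-- The inflation `g ↦ ψ (gN)` to `G` of a representation `ψ` of `G ⧸ N`. -/
def inflate (N : Subgroup G) [N.Normal] (ψ : Representation ℂ (G ⧸ N) V) :
    Representation ℂ G V :=
  MonoidHom.comp ψ (QuotientGroup.mk' N)

end CliffordTheory

/-! ### Pauli and Clifford groups -/

/-- Labels of the standard basis of `(ℂ²)^{⊗ n}`. -/
abbrev Qubits (n : ℕ) : Type := Fin n → Fin 2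

/-- The tensor product `A 0 ⊗ ⋯ ⊗ A (n - 1)` of `2 × 2` matrices. -/
def tensor {n : ℕ} (A : Fin n → Matrix (Fin 2) (Fin 2) ℂ) : Matrix (Qubits n) (Qubits n) ℂ :=
  Matrix.of fun x y => ∏ i, A i (x i) (y i)

theorem tensor_one {n : ℕ} : tensor (1 : Fin n → Matrix (Fin 2) (Fin 2) ℂ) = 1 := by
  ext x y
  simp only [tensor, Matrix.of_apply, Pi.one_apply, Matrix.one_apply]
  by_cases h : x = y
  · simp [h]
  · obtain ⟨i, hi⟩ := Function.ne_iff.1 h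
    rw [if_neg h]
    exact Finset.prod_eq_zero (Finset.mem_univ i) (by simp [hi])

theorem tensor_mul {n : ℕ} (A B : Fin n → Matrix (Fin 2) (Fin 2) ℂ) :
    tensor (A * B) = tensor A * tensor B := by
  ext x y
  simp only [tensor, Matrix.of_apply, Pi.mul_apply, Matrix.mul_apply]
  rw [Finset.prod_univ_sum, Fintype.piFinset_univ]
  exact Finset.sum_congr rfl fun z _ => Finset.prod_mul_distrib

theorem tensor_star {n : ℕ} (A : Fin n → Matrix (Fin 2) (Fin 2) ℂ) :
    star (tensor A) = tensor (star A) := by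
  ext x y
  simp [tensor, Matrix.star_apply]

/-- The tensor product of single-qubit unitaries, as a homomorphism `U(2)^n → U(2^n)`. -/
def tensorU (n : ℕ) :
    (Fin n → Matrix.unitaryGroup (Fin 2) ℂ) →* Matrix.unitaryGroup (Qubits n) ℂ where
  toFun U := ⟨tensor fun i => (U i : Matrix (Fin 2) (Fin 2) ℂ), by
    rw [Matrix.mem_unitaryGroup_iff, tensor_star, ← tensor_mul, ← tensor_one]
    congr 1
    funext i
    exact Matrix.mem_unitaryGroup_iff.1 (U i).2⟩
  map_one' := Subtype.ext tensor_one
  map_mul' U V := Subtype.ext (tensor_mul _ _)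

/-- The Pauli matrix `X`. -/
def pauliX : Matrix.unitaryGroup (Fin 2) ℂ :=
  ⟨!![0, 1; 1, 0], by
    rw [Matrix.mem_unitaryGroup_iff]
    ext i j
    fin_cases i <;> fin_cases j <;> simp [Matrix.mul_apply, Matrix.star_apply]⟩

/-- The Pauli matrix `Z`. -/
def pauliZ : Matrix.unitaryGroup (Fin 2) ℂ :=
  ⟨!![1, 0; 0, -1], by
    rw [Matrix.mem_unitaryGroup_iff]
    ext i j
    fin_cases i <;> fin_cases j <;> simp [Matrix.mul_apply, Matrix.star_apply]⟩

/-- The scalar matrix `i I₂`. -/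
noncomputable def phaseI : Matrix.unitaryGroup (Fin 2) ℂ :=
  ⟨!![Complex.I, 0; 0, Complex.I], by
    rw [Matrix.mem_unitaryGroup_iff]
    ext i j
    fin_cases i <;> fin_cases j <;> simp [Matrix.mul_apply, Matrix.star_apply]⟩

/-- The one-qubit Pauli group `⟨X, Z, i I₂⟩`. -/
noncomputable def pauliOne : Subgroup (Matrix.unitaryGroup (Fin 2) ℂ) :=
  Subgroup.closure {pauliX, pauliZ, phaseI}

/-- The `n`-qubit Pauli group: all `n`-fold tensor products of elements of `⟨X, Z, i I₂⟩`. -/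
noncomputable def pauliGroup (n : ℕ) : Subgroup (Matrix.unitaryGroup (Qubits n) ℂ) :=
  (Subgroup.pi Set.univ fun _ : Fin n => pauliOne).map (tensorU n)

/-- The `n`-qubit Clifford group: the normalizer of the Pauli group in `U(2^n)`. -/
noncomputable def cliff (n : ℕ) : Subgroup (Matrix.unitaryGroup (Qubits n) ℂ) :=
  Subgroup.normalizer (pauliGroup n : Set (Matrix.unitaryGroup (Qubits n) ℂ))

/-- The group `U(1)` of scalar matrices in `U(2^n)`. -/
def phases (n : ℕ) : Subgroup (Matrix.unitaryGroup (Qubits n) ℂ) where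
  carrier := {U | ∃ c : ℂ, (U : Matrix (Qubits n) (Qubits n) ℂ) = c • 1}
  one_mem' := ⟨1, by simp⟩
  mul_mem' := by
    rintro U V ⟨c, hc⟩ ⟨d, hd⟩
    exact ⟨c * d, by simp [hc, hd, smul_smul, mul_comm]⟩
  inv_mem' := by
    rintro U ⟨c, hc⟩
    refine ⟨star c, ?_⟩
    show star (U : Matrix (Qubits n) (Qubits n) ℂ) = _
    rw [hc, star_smul, star_one]

instance phases_normal (n : ℕ) : (phases n).Normal where
  conj_mem := by
    rintro U ⟨c, hc⟩ V
    refine ⟨c, ?_⟩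
    have h : (V : Matrix (Qubits n) (Qubits n) ℂ) * (V⁻¹ : Matrix.unitaryGroup (Qubits n) ℂ) = 1 :=
      congrArg Subtype.val (mul_inv_cancel V)
    show (V : Matrix (Qubits n) (Qubits n) ℂ) * U * (V⁻¹ : Matrix.unitaryGroup (Qubits n) ℂ) = _
    rw [hc, mul_smul_comm, mul_one, smul_mul_assoc, h]

/-- The `n`-qubit projective Clifford group: the Clifford group modulo `U(1)`. -/
abbrev ProjCliff (n : ℕ) : Type := cliff n ⧸ (phases n).subgroupOf (cliff n)

/-- The class `[U]` in the projective Clifford group of a Clifford unitary `U`. -/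
noncomputable def cls (n : ℕ) : cliff n →* ProjCliff n :=
  QuotientGroup.mk' ((phases n).subgroupOf (cliff n))

theorem cls_surjective (n : ℕ) : Function.Surjective (cls n) := QuotientGroup.mk'_surjective _

/-- The `n`-qubit projective Pauli group, as a subgroup of the projective Clifford group. -/
noncomputable def projPauli (n : ℕ) : Subgroup (ProjCliff n) :=
  ((pauliGroup n).subgroupOf (cliff n)).map (cls n)

instance projPauli_normal (n : ℕ) : (projPauli n).Normal :=
  Subgroup.Normal.map Subgroup.normal_in_normalizer _ (cls_surjective n)

theorem pauliGroup_le_cliff (n : ℕ) : pauliGroup n ≤ cliff n := Subgroup.le_normalizer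

/-- The class in the projective Pauli group of an element of the Pauli group. -/
noncomputable def pauliCls {n : ℕ} (P : pauliGroup n) : projPauli n :=
  ⟨cls n ⟨P, pauliGroup_le_cliff n P.2⟩,
    Subgroup.mem_map_of_mem (cls n) (Subgroup.mem_subgroupOf.2 P.2)⟩

/-- `P_j = I^{⊗ j} ⊗ P ⊗ I^{⊗ (n - j - 1)}`, the Pauli operator `P` acting on the qubit `j`. -/
noncomputable def pauliAt {n : ℕ} (j : Fin n) (P : pauliOne) : pauliGroup n :=
  ⟨tensorU n (Pi.mulSingle j (P : Matrix.unitaryGroup (Fin 2) ℂ)), by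
    refine Subgroup.mem_map_of_mem _ ?_
    rw [Subgroup.mem_pi]
    intro i _
    by_cases h : i = j
    · subst h
      simp
    · simp [Pi.mulSingle_eq_of_ne h, one_mem]⟩

/-- `X` as an element of the one-qubit Pauli group. -/
noncomputable def pX : pauliOne := ⟨pauliX, Subgroup.subset_closure (by simp)⟩

/-- `Z` as an element of the one-qubit Pauli group. -/
noncomputable def pZ : pauliOne := ⟨pauliZ, Subgroup.subset_closure (by simp)⟩

/-- The Weyl operator with exponents `(p, q) = x`, up to a phase:
`Z^{p₀} X^{q₀} ⊗ ⋯ ⊗ Z^{p_{n-1}} X^{q_{n-1}}`. -/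
noncomputable def weyl {n : ℕ} (x : Fin n ⊕ Fin n → ZMod 2) : Matrix.unitaryGroup (Qubits n) ℂ :=
  tensorU n fun i => pauliZ ^ (x (Sum.inl i)).val * pauliX ^ (x (Sum.inr i)).val

/-! ### The character `σ₁` -/

section Sign

variable {G : Type*} [Group G] [HasDistribNeg G]

/-- `a` commutes or anticommutes with `y`. -/
def CommOrAnti (a y : G) : Prop := a * y = y * a ∨ a * y = -(y * a)

theorem CommOrAnti.mul {a b y : G} (ha : CommOrAnti a y) (hb : CommOrAnti b y) :
    CommOrAnti (a * b) y := by
  unfold CommOrAnti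
  rcases ha with ha | ha <;> rcases hb with hb | hb
  · left; rw [mul_assoc, hb, ← mul_assoc, ha, mul_assoc]
  · right; rw [mul_assoc, hb, mul_neg, ← mul_assoc, ha, mul_assoc]
  · right; rw [mul_assoc, hb, ← mul_assoc, ha, neg_mul, mul_assoc]
  · left; rw [mul_assoc, hb, mul_neg, ← mul_assoc, ha, neg_mul, neg_neg, mul_assoc]

theorem CommOrAnti.inv {a y : G} (ha : CommOrAnti a y) : CommOrAnti a⁻¹ y := by
  rcases ha with ha | ha
  · left
    rw [inv_mul_eq_iff_eq_mul, ← mul_assoc, ha, mul_inv_cancel_right]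
  · right
    rw [inv_mul_eq_iff_eq_mul, mul_neg, ← mul_assoc, ha, neg_mul, mul_inv_cancel_right, neg_neg]

theorem comm_mul_iff {a b y : G} (hy : ∀ x : G, x ≠ -x) (ha : CommOrAnti a y)
    (hb : CommOrAnti b y) :
    a * b * y = y * (a * b) ↔ (a * y = y * a ↔ b * y = y * b) := by
  rcases ha with ha | ha <;> rcases hb with hb | hb
  · have h : a * b * y = y * (a * b) := by
      rw [mul_assoc, hb, ← mul_assoc, ha, mul_assoc]
    simp [h, ha, hb]
  · have h : a * b * y = -(y * (a * b)) := by
      rw [mul_assoc, hb, mul_neg, ← mul_assoc, ha, mul_assoc]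
    simp [h, ha, hb, (hy _).symm]
  · have h : a * b * y = -(y * (a * b)) := by
      rw [mul_assoc, hb, ← mul_assoc, ha, neg_mul, mul_assoc]
    simp [h, ha, hb, (hy _).symm]
  · have h : a * b * y = y * (a * b) := by
      rw [mul_assoc, hb, mul_neg, ← mul_assoc, ha, neg_mul, neg_neg, mul_assoc]
    simp [h, ha, hb, (hy _).symm]

end Sign

theorem unitary_ne_neg {ι : Type*} [Fintype ι] [DecidableEq ι] [Nonempty ι]
    (x : Matrix.unitaryGroup ι ℂ) : x ≠ -x := by
  intro h
  have h1 : (x : Matrix ι ι ℂ) = -x := congrArg Subtype.val h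
  have h2 : (x : Matrix ι ι ℂ) = 0 := by
    ext i j
    exact self_eq_neg.1 (congrFun (congrFun h1 i) j)
  have h3 := Matrix.mem_unitaryGroup_iff.1 x.2
  rw [h2, zero_mul] at h3
  exact zero_ne_one h3

theorem pauliOne_commOrAnti {P : Matrix.unitaryGroup (Fin 2) ℂ} (hP : P ∈ pauliOne) :
    CommOrAnti P (pauliZ * pauliX) := by
  induction hP using Subgroup.closure_induction with
  | mem x hx =>
    rcases hx with rfl | rfl | rfl
    · right
      ext i j
      fin_cases i <;> fin_cases j <;> simp [Unitary.coe_neg, -Submonoid.mk_mul_mk, pauliX, pauliZ]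
    · right
      ext i j
      fin_cases i <;> fin_cases j <;> simp [Unitary.coe_neg, -Submonoid.mk_mul_mk, pauliX, pauliZ]
    · left
      ext i j
      fin_cases i <;> fin_cases j <;> simp [-Submonoid.mk_mul_mk, pauliX, pauliZ, phaseI]
  | one => left; simp
  | mul x y _ _ hx hy => exact hx.mul hy
  | inv x _ hx => exact hx.inv

/-- `Y₁ = (-i Z X) ⊗ I ⊗ ⋯ ⊗ I` up to a phase, namely `(Z X) ⊗ I ⊗ ⋯ ⊗ I`. -/
noncomputable def firstY (n : ℕ) : Matrix.unitaryGroup (Qubits (n + 1)) ℂ :=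
  tensorU (n + 1) (Pi.mulSingle 0 (pauliZ * pauliX))

theorem tensorU_comm_firstY {n : ℕ} {p : Fin (n + 1) → Matrix.unitaryGroup (Fin 2) ℂ}
    (h : p 0 * (pauliZ * pauliX) = pauliZ * pauliX * p 0) :
    tensorU (n + 1) p * firstY n = firstY n * tensorU (n + 1) p := by
  rw [firstY, ← map_mul, ← map_mul]
  congr 1
  funext i
  refine Fin.cases ?_ (fun j => ?_) i
  · simpa using h
  · simp

theorem tensorU_anti_firstY {n : ℕ} {p : Fin (n + 1) → Matrix.unitaryGroup (Fin 2) ℂ}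
    (h : p 0 * (pauliZ * pauliX) = -(pauliZ * pauliX * p 0)) :
    tensorU (n + 1) p * firstY n = -(firstY n * tensorU (n + 1) p) := by
  rw [firstY, ← map_mul, ← map_mul]
  ext x y
  have h0 : ((p 0 * (pauliZ * pauliX) : Matrix.unitaryGroup (Fin 2) ℂ) :
      Matrix (Fin 2) (Fin 2) ℂ) (x 0) (y 0) =
      -((pauliZ * pauliX * p 0 : Matrix.unitaryGroup (Fin 2) ℂ) :
        Matrix (Fin 2) (Fin 2) ℂ) (x 0) (y 0) :=
    congrFun (congrFun (congrArg Subtype.val h) (x 0)) (y 0)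
  show (∏ i, ((p * Pi.mulSingle (M := fun _ : Fin (n + 1) => Matrix.unitaryGroup (Fin 2) ℂ) 0
      (pauliZ * pauliX) : Fin (n + 1) → Matrix.unitaryGroup (Fin 2) ℂ) i : Matrix (Fin 2) (Fin 2) ℂ) (x i) (y i)) =
    -(∏ i, ((Pi.mulSingle (M := fun _ : Fin (n + 1) => Matrix.unitaryGroup (Fin 2) ℂ) 0
      (pauliZ * pauliX) * p : Fin (n + 1) → Matrix.unitaryGroup (Fin 2) ℂ) i : Matrix (Fin 2) (Fin 2) ℂ) (x i) (y i))
  rw [Fin.prod_univ_succ, Fin.prod_univ_succ, ← neg_mul]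
  refine congrArg₂ (· * ·) h0 (Finset.prod_congr rfl fun i _ => ?_)
  simp only [Pi.mul_apply, Pi.mulSingle_eq_of_ne (Fin.succ_ne_zero i), one_mul, mul_one]

theorem pauliGroup_commOrAnti {n : ℕ} {P : Matrix.unitaryGroup (Qubits (n + 1)) ℂ}
    (hP : P ∈ pauliGroup (n + 1)) : CommOrAnti P (firstY n) := by
  obtain ⟨p, hp, rfl⟩ := hP
  rcases pauliOne_commOrAnti (hp 0 (Set.mem_univ 0)) with h | h
  · exact Or.inl (tensorU_comm_firstY h)
  · exact Or.inr (tensorU_anti_firstY h)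

theorem phases_comm {n : ℕ} {U : Matrix.unitaryGroup (Qubits n) ℂ} (hU : U ∈ phases n)
    (V : Matrix.unitaryGroup (Qubits n) ℂ) : U * V = V * U := by
  obtain ⟨c, hc⟩ := hU
  refine Subtype.ext ?_
  show (U : Matrix (Qubits n) (Qubits n) ℂ) * V = V * (U : Matrix (Qubits n) (Qubits n) ℂ)
  rw [hc]
  simp

theorem cls_eq_iff {n : ℕ} {U V : cliff n} :
    cls n U = cls n V ↔
      ∃ s ∈ phases n, (V : Matrix.unitaryGroup (Qubits n) ℂ) = U * s := by
  refine (QuotientGroup.eq (a := U) (b := V)).trans ?_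
  rw [Subgroup.mem_subgroupOf]
  constructor
  · intro h
    exact ⟨_, h, by simp⟩
  · rintro ⟨s, hs, h⟩
    simpa [h] using hs

theorem mul_phase_comm {n : ℕ} {U s : Matrix.unitaryGroup (Qubits (n + 1)) ℂ}
    (hs : s ∈ phases (n + 1)) (h : CommOrAnti U (firstY n)) : CommOrAnti (U * s) (firstY n) :=
  h.mul (Or.inl (phases_comm hs _))

theorem commOrAnti_of_mem_projPauli {n : ℕ} {U : cliff (n + 1)}
    (hU : cls (n + 1) U ∈ projPauli (n + 1)) :
    CommOrAnti (U : Matrix.unitaryGroup (Qubits (n + 1)) ℂ) (firstY n) := by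
  obtain ⟨P, hP, h⟩ := hU
  obtain ⟨s, hs, h'⟩ := cls_eq_iff.1 h
  rw [h']
  exact mul_phase_comm hs (pauliGroup_commOrAnti (Subgroup.mem_subgroupOf.1 hP))

theorem comm_firstY_congr {n : ℕ} {U V : cliff (n + 1)} (h : cls (n + 1) U = cls (n + 1) V) :
    ((U : Matrix.unitaryGroup (Qubits (n + 1)) ℂ) * firstY n = firstY n * U) ↔
      ((V : Matrix.unitaryGroup (Qubits (n + 1)) ℂ) * firstY n = firstY n * V) := by
  obtain ⟨s, hs, h'⟩ := cls_eq_iff.1 h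
  rw [h', mul_assoc, phases_comm hs, ← mul_assoc, ← mul_assoc, mul_left_inj]

open Classical in
/-- The character `σ₁` of the projective Pauli group: `σ₁ [P] = 1` if `P` commutes with `Y₁`, and
`σ₁ [P] = -1` if it anticommutes with `Y₁`. By `sigmaOne_X` and `sigmaOne_Z` below, it is the
character with `σ₁ [X₁] = σ₁ [Z₁] = -1` that is `1` at `[X_j]` and `[Z_j]` for all other `j`. -/
noncomputable def sigmaOne (n : ℕ) : projPauli (n + 1) →* ℂˣ where
  toFun g := if ∃ U : cliff (n + 1), cls (n + 1) U = g ∧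
      (U : Matrix.unitaryGroup (Qubits (n + 1)) ℂ) * firstY n = firstY n * U then 1 else -1
  map_one' := if_pos ⟨1, map_one _, by simp⟩
  map_mul' := by
    have key : ∀ (g : projPauli (n + 1)) (U : cliff (n + 1)), cls (n + 1) U = g →
        ((∃ V : cliff (n + 1), cls (n + 1) V = g ∧
          (V : Matrix.unitaryGroup (Qubits (n + 1)) ℂ) * firstY n = firstY n * V) ↔
          (U : Matrix.unitaryGroup (Qubits (n + 1)) ℂ) * firstY n = firstY n * U) := by
      intro g U hU
      constructor
      · rintro ⟨V, hV, h⟩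
        exact (comm_firstY_congr (hV.trans hU.symm)).1 h
      · intro h
        exact ⟨U, hU, h⟩
    intro g h
    obtain ⟨U, hU⟩ := cls_surjective _ (g : ProjCliff (n + 1))
    obtain ⟨V, hV⟩ := cls_surjective _ (h : ProjCliff (n + 1))
    have hUV : cls (n + 1) (U * V) = (g * h : projPauli (n + 1)) := by
      rw [map_mul, hU, hV]; rfl
    have e := comm_mul_iff unitary_ne_neg
      (commOrAnti_of_mem_projPauli (U := U) (by rw [hU]; exact g.2))
      (commOrAnti_of_mem_projPauli (U := V) (by rw [hV]; exact h.2))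
    simp only [key _ _ hU, key _ _ hV, key _ _ hUV]
    rw [Subgroup.coe_mul]
    by_cases h1 : (U : Matrix.unitaryGroup (Qubits (n + 1)) ℂ) * firstY n = firstY n * U <;>
      by_cases h2 : (V : Matrix.unitaryGroup (Qubits (n + 1)) ℂ) * firstY n = firstY n * V <;>
      simp only [e, h1, h2, if_true, if_false, mul_one, one_mul, iff_true, iff_false, not_true, neg_mul_neg]

theorem sigmaOne_of_comm {n : ℕ} {P : pauliGroup (n + 1)}
    (h : (P : Matrix.unitaryGroup (Qubits (n + 1)) ℂ) * firstY n = firstY n * P) :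
    sigmaOne n (pauliCls P) = 1 :=
  if_pos ⟨⟨P, pauliGroup_le_cliff _ P.2⟩, rfl, h⟩

theorem sigmaOne_of_anti {n : ℕ} {P : pauliGroup (n + 1)}
    (h : (P : Matrix.unitaryGroup (Qubits (n + 1)) ℂ) * firstY n = -(firstY n * P)) :
    sigmaOne n (pauliCls P) = -1 := by
  refine if_neg ?_
  rintro ⟨U, hU, hc⟩
  have h' := (comm_firstY_congr (V := ⟨P, pauliGroup_le_cliff _ P.2⟩) hU).1 hc
  exact unitary_ne_neg _ (h'.symm.trans h)

theorem sigmaOne_at {n : ℕ} (j : Fin (n + 1)) (P : pauliOne)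
    (hP : (P : Matrix.unitaryGroup (Fin 2) ℂ) * (pauliZ * pauliX) = -(pauliZ * pauliX * P)) :
    sigmaOne n (pauliCls (pauliAt j P)) = if j = 0 then -1 else 1 := by
  split_ifs with h
  · subst h
    exact sigmaOne_of_anti (tensorU_anti_firstY (by simpa using hP))
  · exact sigmaOne_of_comm (tensorU_comm_firstY (by simp [Pi.mulSingle_eq_of_ne (Ne.symm h)]))

/-- `σ₁ [X₁] = -1`, and `σ₁ [X_j] = 1` for `j ≠ 1`. -/
theorem sigmaOne_X {n : ℕ} (j : Fin (n + 1)) :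
    sigmaOne n (pauliCls (pauliAt j pX)) = if j = 0 then -1 else 1 := by
  refine sigmaOne_at j pX ?_
  ext a b
  fin_cases a <;> fin_cases b <;> simp [pX, Unitary.coe_neg, -Submonoid.mk_mul_mk, pauliX, pauliZ]

/-- `σ₁ [Z₁] = -1`, and `σ₁ [Z_j] = 1` for `j ≠ 1`. -/
theorem sigmaOne_Z {n : ℕ} (j : Fin (n + 1)) :
    sigmaOne n (pauliCls (pauliAt j pZ)) = if j = 0 then -1 else 1 := by
  refine sigmaOne_at j pZ ?_
  ext a b
  fin_cases a <;> fin_cases b <;> simp [pZ, Unitary.coe_neg, -Submonoid.mk_mul_mk, pauliX, pauliZ]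

/-! ### The inertia subgroup -/

/-- The Hadamard matrix. -/
noncomputable def hadamard : Matrix (Fin 2) (Fin 2) ℂ :=
  ((Real.sqrt 2 : ℝ) : ℂ)⁻¹ • !![1, 1; 1, -1]

/-- The matrix `A` acting on the qubit `j`. -/
def onQubit {n : ℕ} (j : Fin n) (A : Matrix (Fin 2) (Fin 2) ℂ) : Matrix (Qubits n) (Qubits n) ℂ :=
  tensor (Function.update 1 j A)

/-- The controlled-`X` gate with control `j` and target `k`: the permutation matrix that maps the
basis vector `y` to the one with `y k` replaced by `y k + y j`. -/
def ctrlX {n : ℕ} (j k : Fin n) : Matrix (Qubits n) (Qubits n) ℂ :=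
  Matrix.of fun x y => if x = Function.update y k (y k + y j) then 1 else 0

/-- `M = CX_{1,2} (Z₁ H₁ X₂) CX_{1,2}`, where the qubits `1` and `2` are called `j` and `k`. -/
noncomputable def gateM {n : ℕ} (j k : Fin n) : Matrix (Qubits n) (Qubits n) ℂ :=
  ctrlX j k * (onQubit j pauliZ.1 * onQubit j hadamard * onQubit k pauliX.1) * ctrlX j k

/-- `I ⊗ A`: the matrix `A` acting on all the qubits but the first. -/
def idTensor {n : ℕ} (A : Matrix (Qubits n) (Qubits n) ℂ) :
    Matrix (Qubits (n + 1)) (Qubits (n + 1)) ℂ :=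
  Matrix.of fun x y => if x 0 = y 0 then A (Fin.tail x) (Fin.tail y) else 0

/-- The generators of the inertia subgroup on `n + 1` qubits: `M` (if there are two qubits), `H₁`,
`X₁` and `I ⊗ A` for all `n`-qubit Clifford unitaries `A`. -/
def inertiaGenerators (n : ℕ) : Set (Matrix (Qubits (n + 1)) (Qubits (n + 1)) ℂ) :=
  {B | ∃ k : Fin (n + 1), (k : ℕ) = 1 ∧ B = gateM 0 k} ∪
    {onQubit 0 hadamard, onQubit 0 pauliX.1} ∪
    {B | ∃ A ∈ cliff n, B = idTensor (A : Matrix (Qubits n) (Qubits n) ℂ)}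

/-- The subgroup `IN = ⟨[M], [H₁], [X₁], [I ⊗ A] : A⟩` of the projective Clifford group on `n + 1`
qubits. -/
noncomputable def inertiaIN (n : ℕ) : Subgroup (ProjCliff (n + 1)) :=
  Subgroup.closure {g | ∃ U : cliff (n + 1), cls (n + 1) U = g ∧ U.1.1 ∈ inertiaGenerators n}

/-! ### The two kinds of representations -/

section Kinds

variable {n : ℕ} {W : Type u} [AddCommGroup W] [Module ℂ W]

/-- The quotient `IN / ℤ₂^{2(n + 1)}` of `IN` by the projective Pauli group. -/
abbrev InertiaQuot (n : ℕ) : Type :=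
  inertiaIN n ⧸ (projPauli (n + 1)).subgroupOf (inertiaIN n)

/-- `Ind (σ' ⊗ ψ̃)`, induced from `IN` to the projective Clifford group. -/
noncomputable def inducedKind (σ' : Representation ℂ (inertiaIN n) ℂ)
    (ψ : Representation ℂ (InertiaQuot n) W) :=
  Representation.ind (inertiaIN n).subtype
    (Representation.tprod σ' (inflate ((projPauli (n + 1)).subgroupOf (inertiaIN n)) ψ))

/-- The symplectic group `Sp(2n, 2)`. -/
abbrev Sp (n : ℕ) : Type := Matrix.symplecticGroup (Fin n) (ZMod 2)

/-- The inflation to the projective Clifford group of a representation of `Sp(2n, 2)`, viewed as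
the quotient of the projective Clifford group by the projective Pauli group. -/
noncomputable def inflatedKind (e : (ProjCliff n ⧸ projPauli n) ≃* Sp n)
    (ψ : Representation ℂ (Sp n) W) : Representation ℂ (ProjCliff n) W :=
  inflate (projPauli n) (MonoidHom.comp ψ e.toMonoidHom)

end Kinds

/-!
Write `v` for the label of `Z₁ X₁`, which is `Y₁` up to a phase. Conjugation on the classes of the
Weyl operators makes the projective Clifford group act on the space of labels by isometries of the
symplectic form `ω` which records the commutation signs, and the kernel of this action is the
projective Pauli group (`ker_toSp`). The character `σ₁` is `x ↦ (-1) ^ ω(x, v)`, so its inertia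
group is the stabilizer of `v` (`sigmaOne_conj_iff`).

If `P` is a Pauli operator with label `a` and `P² = -1`, then `(1 + P) / √2` is a Clifford unitary
that acts as the transvection `x ↦ x + ω(x, a) a` (`cliffAction_pauliRotation`). The isometries
that fix a given vector are the products of the transvections along the vectors orthogonal to it
(`isometry_induction`). For the vector `0` this gives surjectivity onto `Sp(2n, 2)`. For `v` it
reduces the inclusion of the stabilizer in `IN` to realizing in `IN` the transvections along the
vectors orthogonal to `v`. Those along labels supported on the other qubits come from gates
`I ⊗ A`. Up to Pauli operators, `H₁` and `M` are the unitaries `(1 + P) / √2` for `P` with labels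
`v` and `v` plus the label of `X₂`, and conjugating `M` by gates `I ⊗ A` gives all the others
(`mem_inertiaTransvections`). Hence `IN` is the stabilizer of `v` (`mem_inertiaIN_iff`). In
particular `U Y₁ U⁻¹ = ± Y₁` for every `U` with class in `IN`, and this sign is an extension of
`σ₁` (`conjSign`).

The classification is Clifford theory for the normal subgroup of Pauli classes. The `σ₁`-weight
space of an induced representation is the representation induced from
(`mem_weightSpace_ind_iff`), which yields irreducibility (`IsIrreducible.ind`) and the absence of
repetitions (`nonempty_equiv_of_ind`). Conversely, an irreducible representation in which `σ₁`
occurs is induced from its weight space, and dividing by the extension makes this weight space a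
representation of the quotient (`exists_equiv_ind_tprod_inflate`). Finally, the Clifford group
permutes the nonzero labels, hence the nontrivial characters of the Pauli classes, transitively; so
if `σ₁` does not occur, the Pauli classes act trivially (`weightSpace_sigmaOne_ne_bot`), and the
representation is inflated from `Sp(2n, 2)`.
-/

/-! ### Clifford theory for a linear character of a normal subgroup -/

namespace Representation

section Irreducible

variable {G k V W : Type*} [Monoid G] [Field k] [AddCommGroup V] [Module k V]
  [AddCommGroup W] [Module k W]

theorem isIrreducible_iff_forall_submodule {ρ : Representation k G V} :
    ρ.IsIrreducible ↔ Nontrivial V ∧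
      ∀ p : Submodule k V, (∀ g, ∀ v ∈ p, ρ g v ∈ p) → p = ⊥ ∨ p = ⊤ := by
  constructor
  · intro h
    constructor
    · by_contra hV
      rw [not_nontrivial_iff_subsingleton] at hV
      obtain ⟨a, b, hab⟩ := h.toNontrivial.exists_pair_ne
      exact hab (Subrepresentation.toSubmodule_injective (Subsingleton.elim _ _))
    · intro p hp
      refine (h.eq_bot_or_eq_top ⟨p, fun g v hv => hp g v hv⟩).imp (fun h => ?_) (fun h => ?_)
      · exact congrArg Subrepresentation.toSubmodule h
      · exact congrArg Subrepresentation.toSubmodule h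
  · rintro ⟨hV, h⟩
    refine { exists_pair_ne := ⟨⊥, ⊤, fun e => ?_⟩, eq_bot_or_eq_top := fun p => ?_ }
    · exact bot_ne_top (α := Submodule k V) (congrArg Subrepresentation.toSubmodule e)
    · refine (h p.toSubmodule fun g v hv => p.apply_mem_toSubmodule g hv).imp
        (fun h => ?_) (fun h => ?_)
      · exact Subrepresentation.toSubmodule_injective h
      · exact Subrepresentation.toSubmodule_injective h

/-- Irreducibility depends only on the stable subspaces, so it can be moved along a linear
equivalence under which stable subspaces pull back to stable ones, even when the acting monoids
differ. -/
theorem IsIrreducible.of_linearEquiv {H : Type*} [Monoid H] {ρ : Representation k G V}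
    {τ : Representation k H W} (hρ : ρ.IsIrreducible) (e : V ≃ₗ[k] W)
    (he : ∀ p : Submodule k W, (∀ h, ∀ w ∈ p, τ h w ∈ p) → ∀ g, ∀ v, e v ∈ p → e (ρ g v) ∈ p) :
    τ.IsIrreducible := by
  rw [isIrreducible_iff_forall_submodule] at hρ ⊢
  obtain ⟨hV, hρ⟩ := hρ
  refine ⟨e.symm.toEquiv.nontrivial, fun p hp => ?_⟩
  refine (hρ (p.comap e.toLinearMap) fun g v hv => he p hp g v hv).imp (fun h => ?_) (fun h => ?_)
  · rw [eq_bot_iff] at h ⊢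
    intro w hw
    have : e.symm w ∈ p.comap e.toLinearMap := by simpa using hw
    simpa using h this
  · rw [eq_top_iff] at h ⊢
    intro w _
    simpa using h (Submodule.mem_top (x := e.symm w))

theorem nonempty_equiv_of_linearEquiv {ρ : Representation k G V} {τ : Representation k G W}
    (e : V ≃ₗ[k] W) (he : ∀ g v, e (ρ g v) = τ g (e v)) : Nonempty (ρ.Equiv τ) :=
  ⟨Equiv.mk e fun g => LinearMap.ext (he g)⟩

theorem Equiv.apply_apply {ρ : Representation k G V} {τ : Representation k G W}
    (e : ρ.Equiv τ) (g : G) (v : V) : e.toLinearEquiv (ρ g v) = τ g (e.toLinearEquiv v) :=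
  LinearMap.congr_fun (e.isIntertwining' g) v

end Irreducible

section WeightSpace

variable {G : Type*} [Group G] {N : Subgroup G} {V : Type*} [AddCommGroup V] [Module ℂ V]

/-- The subspace on which the subgroup `N` acts through the character `χ`. -/
def weightSpace (ρ : Representation ℂ G V) (χ : N →* ℂˣ) : Submodule ℂ V where
  carrier := {v | ∀ n : N, ρ n v = (χ n : ℂ) • v}
  zero_mem' n := by simp
  add_mem' {v w} hv hw n := by rw [map_add, hv n, hw n, smul_add]
  smul_mem' c v hv n := by rw [map_smul, hv n, smul_comm]

theorem mem_weightSpace {ρ : Representation ℂ G V} {χ : N →* ℂˣ} {v : V} :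
    v ∈ ρ.weightSpace χ ↔ ∀ n : N, ρ n v = (χ n : ℂ) • v := Iff.rfl

/-- The group permutes the weight spaces: `ρ g` maps the `χ`-weight space to the weight space of
the conjugate character. -/
theorem weightSpace_apply_apply [N.Normal] {ρ : Representation ℂ G V} {χ : N →* ℂˣ} {v : V}
    (hv : v ∈ ρ.weightSpace χ) (g : G) (n : N) :
    ρ n (ρ g v) = (χ (MulAut.conjNormal g⁻¹ n) : ℂ) • ρ g v := by
  rw [← map_smul, ← hv, ← Module.End.mul_apply, ← Module.End.mul_apply, ← map_mul, ← map_mul]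
  congr 2
  simp [mul_assoc]

variable [Finite N]

open Classical in
/-- The projection `|N|⁻¹ ∑ₙ χ(n)⁻¹ ρ(n)` onto `weightSpace ρ χ`. -/
noncomputable def weightProj (ρ : Representation ℂ G V) (χ : N →* ℂˣ) : V →ₗ[ℂ] V :=
  letI := Fintype.ofFinite N
  (Nat.card N : ℂ)⁻¹ • ∑ n : N, ((χ n)⁻¹ : ℂˣ).1 • ρ n

theorem weightProj_apply_of_mem {ρ : Representation ℂ G V} {χ : N →* ℂˣ} {v : V}
    (hv : v ∈ ρ.weightSpace χ) : ρ.weightProj χ v = v := by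
  let _ := Fintype.ofFinite N
  have h0 : (Nat.card N : ℂ) ≠ 0 := Nat.cast_ne_zero.2 Nat.card_pos.ne'
  simp only [weightProj, LinearMap.smul_apply, LinearMap.sum_apply, mem_weightSpace.1 hv, smul_smul,
    Units.inv_mul, one_smul, Finset.sum_const, Finset.card_univ, ← Nat.cast_smul_eq_nsmul ℂ]
  rw [Fintype.card_eq_nat_card, inv_mul_cancel₀ h0, one_smul]

theorem apply_weightProj (ρ : Representation ℂ G V) (χ : N →* ℂˣ) (n : N) (v : V) :
    ρ n (ρ.weightProj χ v) = (χ n : ℂ) • ρ.weightProj χ v := by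
  let _ := Fintype.ofFinite N
  simp only [weightProj, LinearMap.smul_apply, LinearMap.sum_apply, map_smul, map_sum]
  rw [smul_comm]
  congr 1
  rw [Finset.smul_sum, ← Equiv.sum_comp (Equiv.mulLeft n) fun m => (χ n : ℂ) • _]
  refine Finset.sum_congr rfl fun m _ => ?_
  simp only [Equiv.coe_mulLeft, map_mul, mul_inv, smul_smul, Subgroup.coe_mul,
    Module.End.mul_apply, Units.val_mul, Units.mul_inv_cancel_left]

theorem weightProj_apply (ρ : Representation ℂ G V) (χ : N →* ℂˣ) (n : N) (v : V) :
    ρ.weightProj χ (ρ n v) = (χ n : ℂ) • ρ.weightProj χ v := by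
  let _ := Fintype.ofFinite N
  simp only [weightProj, LinearMap.smul_apply, LinearMap.sum_apply]
  rw [smul_comm]
  congr 1
  rw [Finset.smul_sum, ← Equiv.sum_comp (Equiv.mulRight n) fun m => (χ n : ℂ) • _]
  refine Finset.sum_congr rfl fun m _ => ?_
  simp [smul_smul, map_mul]

theorem weightProj_eq_zero {ρ : Representation ℂ G V} {χ : N →* ℂˣ} {v : V} {n : N} {c : ℂ}
    (hv : ρ n v = c • v) (hc : c ≠ χ n) : ρ.weightProj χ v = 0 := by
  have h := weightProj_apply ρ χ n v
  rw [hv, map_smul, ← sub_eq_zero, ← sub_smul] at h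
  exact (smul_eq_zero.1 h).resolve_left (sub_ne_zero.2 hc)

theorem weightProj_mem_of_stable {ρ : Representation ℂ G V} (χ : N →* ℂˣ) {p : Submodule ℂ V}
    (hp : ∀ g, ∀ v ∈ p, ρ g v ∈ p) {v : V} (hv : v ∈ p) : ρ.weightProj χ v ∈ p := by
  let _ := Fintype.ofFinite N
  simp only [weightProj, LinearMap.smul_apply, LinearMap.sum_apply]
  exact p.smul_mem _ (p.sum_mem fun n _ => p.smul_mem _ (hp _ _ hv))

theorem weightProj_intertwines {W : Type*} [AddCommGroup W] [Module ℂ W]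
    {ρ : Representation ℂ G V} {τ : Representation ℂ G W} (χ : N →* ℂˣ) (f : V →ₗ[ℂ] W)
    (hf : ∀ g v, f (ρ g v) = τ g (f v)) (v : V) :
    f (ρ.weightProj χ v) = τ.weightProj χ (f v) := by
  let _ := Fintype.ofFinite N
  simp [weightProj, hf]

end WeightSpace

section Induced

variable {G : Type*} [Group G] {I : Subgroup G} {W : Type*} [AddCommGroup W] [Module ℂ W]
  (τ : Representation ℂ I W)

/-- The canonical map of a representation of a subgroup into the induced representation. -/
noncomputable def indIncl : W →ₗ[ℂ] IndV I.subtype τ := IndV.mk I.subtype τ 1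

theorem ind_apply_indIncl (g : G) (w : W) :
    ind I.subtype τ g (indIncl τ w) = IndV.mk I.subtype τ g⁻¹ w := by
  rw [indIncl, ind_mk, one_mul]

theorem ind_apply_indIncl_of_mem (i : I) (w : W) :
    ind I.subtype τ i (indIncl τ w) = indIncl τ (τ i w) := by
  rw [ind_apply_indIncl, indIncl]
  have := Coinvariants.mk_self_apply (tprod ((leftRegular ℂ G).comp I.subtype) τ) i
    (TensorProduct.tmul ℂ (MonoidAlgebra.single (i : G)⁻¹ 1) w)
  simpa [IndV.mk] using this.symm

theorem span_ind_indIncl :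
    Submodule.span ℂ {x | ∃ g w, x = ind I.subtype τ g (indIncl τ w)} = ⊤ := by
  rw [← Submodule.ker_mkQ (Submodule.span ℂ _), LinearMap.ker_eq_top]
  refine IndV.hom_ext _ _ fun h => LinearMap.ext fun w => ?_
  simp only [LinearMap.comp_apply (Submodule.mkQ _), LinearMap.zero_comp, LinearMap.zero_apply,
    Submodule.mkQ_apply, Submodule.Quotient.mk_eq_zero]
  refine Submodule.subset_span ⟨h⁻¹, w, ?_⟩
  rw [ind_apply_indIncl, inv_inv]

/-- Frobenius reciprocity: an intertwining map on `W` extends to the induced representation. -/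
theorem exists_ind_lift {V : Type*} [AddCommGroup V] [Module ℂ V] {ρ : Representation ℂ G V}
    (f : W →ₗ[ℂ] V) (hf : ∀ (i : I) w, f (τ i w) = ρ i (f w)) :
    ∃ F : IndV I.subtype τ →ₗ[ℂ] V, (∀ g x, F (ind I.subtype τ g x) = ρ g (F x)) ∧
      ∀ w, F (indIncl τ w) = f w := by
  let F : IndV I.subtype τ →ₗ[ℂ] V := Coinvariants.lift _
    (TensorProduct.lift <| (Finsupp.lift _ _ _ fun h => ρ h⁻¹ ∘ₗ f) ∘ₗ
      (MonoidAlgebra.coeffLinearEquiv ℂ).toLinearMap)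
    fun g ↦ by
      ext h x
      simp [ofMulAction_single, hf]
  have hF : ∀ h w, F (IndV.mk I.subtype τ h w) = ρ h⁻¹ (f w) := fun h w => by
    simp [F]
  refine ⟨F, fun g => LinearMap.congr_fun (f := F ∘ₗ ind I.subtype τ g) (g := ρ g ∘ₗ F) ?_,
    fun w => ?_⟩
  · refine IndV.hom_ext _ _ fun h => LinearMap.ext fun w => ?_
    show F (ind I.subtype τ g (IndV.mk I.subtype τ h w)) = ρ g (F (IndV.mk I.subtype τ h w))
    rw [ind_mk, hF, hF]
    simp
  · rw [indIncl, hF]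
    simp

open Classical in
theorem indIncl_injective : Function.Injective (indIncl τ) := by
  -- the component at the trivial coset is a left inverse
  let F : IndV I.subtype τ →ₗ[ℂ] W := Coinvariants.lift _
    (TensorProduct.lift <| (Finsupp.lift _ _ _ fun h =>
      if hh : h ∈ I then τ ⟨h, hh⟩⁻¹ else 0) ∘ₗ
      (MonoidAlgebra.coeffLinearEquiv ℂ).toLinearMap)
    fun g ↦ by
      ext h x
      by_cases hh : h ∈ I
      · have hgh : (g : G) * h ∈ I := I.mul_mem g.2 hh
        have : (⟨g * h, hgh⟩ : I)⁻¹ = ⟨h, hh⟩⁻¹ * g⁻¹ := by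
          ext; simp
        simp [ofMulAction_single, hh, hgh, this]
      · have hgh : (g : G) * h ∉ I := fun h' => hh ((I.mul_mem_cancel_left g.2).1 h')
        simp [ofMulAction_single, hh, hgh]
  have hF : ∀ w, F (indIncl τ w) = w := fun w => by
    have : (⟨1, I.one_mem⟩ : I) = 1 := rfl
    simp [F, indIncl, this]
  exact Function.LeftInverse.injective hF

end Induced

section StableCharacter

variable {G : Type*} [Group G] {N : Subgroup G} [N.Normal] {χ : N →* ℂˣ}
  {I : Subgroup G} {V : Type*} [AddCommGroup V] [Module ℂ V] {ρ : Representation ℂ G V}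

theorem apply_mem_weightSpace (hI : ∀ g, g ∈ I ↔ ∀ n : N, χ (MulAut.conjNormal g⁻¹ n) = χ n)
    {g : G} (hg : g ∈ I) {v : V} (hv : v ∈ ρ.weightSpace χ) : ρ g v ∈ ρ.weightSpace χ := by
  intro n
  rw [weightSpace_apply_apply hv, (hI g).1 hg]

theorem weightProj_apply_of_notMem [Finite N]
    (hI : ∀ g, g ∈ I ↔ ∀ n : N, χ (MulAut.conjNormal g⁻¹ n) = χ n)
    {g : G} (hg : g ∉ I) {v : V} (hv : v ∈ ρ.weightSpace χ) : ρ.weightProj χ (ρ g v) = 0 := by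
  rw [hI] at hg
  push Not at hg
  obtain ⟨n, hn⟩ := hg
  exact weightProj_eq_zero (weightSpace_apply_apply hv g n) (fun h => hn (Units.ext h))

variable {W : Type*} [AddCommGroup W] [Module ℂ W] {τ : Representation ℂ I W}

omit [N.Normal] in
theorem indIncl_mem_weightSpace (hN : N ≤ I)
    (hτ : ∀ (n : N) w, τ (Subgroup.inclusion hN n) w = (χ n : ℂ) • w) (w : W) :
    indIncl τ w ∈ (ind I.subtype τ).weightSpace χ := fun n => by
  rw [← map_smul, ← hτ, ← ind_apply_indIncl_of_mem]
  rfl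

variable [Finite N] (hN : N ≤ I) (hI : ∀ g, g ∈ I ↔ ∀ n : N, χ (MulAut.conjNormal g⁻¹ n) = χ n)
  (hτ : ∀ (n : N) w, τ (Subgroup.inclusion hN n) w = (χ n : ℂ) • w)

include hN hI hτ

open Classical in
theorem weightProj_ind (g : G) (w : W) :
    (ind I.subtype τ).weightProj χ (ind I.subtype τ g (indIncl τ w)) =
      if g ∈ I then ind I.subtype τ g (indIncl τ w) else 0 := by
  have hw := indIncl_mem_weightSpace hN hτ w
  split_ifs with hg
  · exact weightProj_apply_of_mem (apply_mem_weightSpace hI hg hw)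
  · exact weightProj_apply_of_notMem hI hg hw

theorem weightProj_ind_mem_range (x : IndV I.subtype τ) :
    (ind I.subtype τ).weightProj χ x ∈ LinearMap.range (indIncl τ) := by
  have h : (⊤ : Submodule ℂ (IndV I.subtype τ)) ≤
      (LinearMap.range (indIncl τ)).comap ((ind I.subtype τ).weightProj χ) := by
    rw [← span_ind_indIncl, Submodule.span_le]
    rintro _ ⟨g, w, rfl⟩
    rw [SetLike.mem_coe, Submodule.mem_comap, weightProj_ind hN hI hτ]
    split_ifs with hg
    · exact ⟨τ ⟨g, hg⟩ w, (ind_apply_indIncl_of_mem τ ⟨g, hg⟩ w).symm⟩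
    · exact Submodule.zero_mem _
  exact h Submodule.mem_top

/-- The `χ`-weight space of the induced representation is the inducing representation: the
translates by elements outside `I` belong to other characters. -/
theorem mem_weightSpace_ind_iff {x : IndV I.subtype τ} :
    x ∈ (ind I.subtype τ).weightSpace χ ↔ ∃ w, indIncl τ w = x := by
  constructor
  · intro hx
    rw [← weightProj_apply_of_mem hx]
    exact weightProj_ind_mem_range hN hI hτ x
  · rintro ⟨w, rfl⟩
    exact indIncl_mem_weightSpace hN hτ w

variable [Finite G]

/-- A vector of the induced representation vanishes if all its translates project to zero: the
operator `∑ g, ρ(g)⁻¹ p ρ(g)`, where `p` is the projection, is `|I|` times the identity. -/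
theorem eq_zero_of_weightProj_ind {x : IndV I.subtype τ}
    (hx : ∀ g, (ind I.subtype τ).weightProj χ (ind I.subtype τ g x) = 0) : x = 0 := by
  classical
  let _ := Fintype.ofFinite G
  have key : ∑ g : G, ind I.subtype τ g⁻¹ ∘ₗ (ind I.subtype τ).weightProj χ ∘ₗ ind I.subtype τ g =
      (Fintype.card I : ℂ) • LinearMap.id := by
    refine LinearMap.ext_on_range (v := fun y : G × W => ind I.subtype τ y.1 (indIncl τ y.2)) ?_ ?_
    · rw [← span_ind_indIncl]
      congr 1
      ext x
      simp [eq_comm]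
    · rintro ⟨h, w⟩
      have : ∀ g : G, ind I.subtype τ g⁻¹ ((ind I.subtype τ).weightProj χ
          (ind I.subtype τ g (ind I.subtype τ h (indIncl τ w)))) =
          if g * h ∈ I then ind I.subtype τ h (indIncl τ w) else 0 := fun g => by
        rw [← Module.End.mul_apply (ind I.subtype τ g), ← map_mul, weightProj_ind hN hI hτ]
        split_ifs
        · rw [← Module.End.mul_apply, ← map_mul, inv_mul_cancel_left]
        · exact map_zero _
      simp only [LinearMap.sum_apply, LinearMap.comp_apply, LinearMap.smul_apply,
        LinearMap.id_apply, this]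
      rw [← Equiv.sum_comp (Equiv.mulRight h⁻¹)]
      simp only [Equiv.coe_mulRight, inv_mul_cancel_right]
      rw [← Finset.sum_filter, Finset.sum_const, ← Nat.cast_smul_eq_nsmul ℂ, Fintype.card_subtype]
  have h := LinearMap.congr_fun key x
  simp only [LinearMap.sum_apply, LinearMap.comp_apply, hx, map_zero, Finset.sum_const_zero,
    LinearMap.smul_apply, LinearMap.id_apply] at h
  exact (smul_eq_zero.1 h.symm).resolve_left (Nat.cast_ne_zero.2 Fintype.card_ne_zero)

/-- The representation induced from an irreducible representation of the stabilizer of `χ` lying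
over `χ` is irreducible. -/
theorem IsIrreducible.ind (hirr : τ.IsIrreducible) :
    (Representation.ind I.subtype τ).IsIrreducible := by
  rw [isIrreducible_iff_forall_submodule] at hirr ⊢
  obtain ⟨hW, hirr⟩ := hirr
  refine ⟨(indIncl_injective τ).nontrivial, fun p hp => ?_⟩
  refine (hirr (p.comap (indIncl τ)) fun i w hw => ?_).imp (fun h => ?_) (fun h => ?_)
  · rw [Submodule.mem_comap, ← ind_apply_indIncl_of_mem]
    exact hp _ _ hw
  · rw [eq_bot_iff]
    intro x hx
    refine eq_zero_of_weightProj_ind hN hI hτ fun g => ?_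
    obtain ⟨w, hw⟩ := weightProj_ind_mem_range hN hI hτ (Representation.ind I.subtype τ g x)
    have : w ∈ p.comap (indIncl τ) := by
      rw [Submodule.mem_comap, hw]
      exact weightProj_mem_of_stable χ hp (hp g x hx)
    rw [h, Submodule.mem_bot] at this
    rw [← hw, this, map_zero]
  · rw [eq_top_iff, ← span_ind_indIncl, Submodule.span_le]
    rintro _ ⟨g, w, rfl⟩
    exact hp g _ (h.ge Submodule.mem_top)

/-- An injective map of the representation `τ` of the stabilizer of `χ` onto the `χ`-weight space
of an irreducible representation `ρ` exhibits `ρ` as the representation induced from `τ`. -/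
theorem IsIrreducible.nonempty_equiv_ind (hirr : ρ.IsIrreducible) [Nontrivial W] {f : W →ₗ[ℂ] V}
    (hf : ∀ (i : I) w, f (τ i w) = ρ i (f w)) (hinj : Function.Injective f) :
    Nonempty (ρ.Equiv (Representation.ind I.subtype τ)) := by
  rw [isIrreducible_iff_forall_submodule] at hirr
  obtain ⟨F, hF, hFj⟩ := exists_ind_lift τ f hf
  have hker : LinearMap.ker F = ⊥ := by
    rw [eq_bot_iff]
    intro x hx
    refine eq_zero_of_weightProj_ind hN hI hτ fun g => ?_
    obtain ⟨w, hw⟩ := weightProj_ind_mem_range hN hI hτ (Representation.ind I.subtype τ g x)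
    have h : f w = 0 := by
      rw [← hFj, hw, weightProj_intertwines χ F hF, hF, LinearMap.mem_ker.1 hx, map_zero, map_zero]
    rw [← hw, (map_eq_zero_iff f hinj).1 h, map_zero]
  have hrange : LinearMap.range F = ⊤ := by
    refine (hirr.2 _ ?_).resolve_left fun h => ?_
    · rintro g _ ⟨x, rfl⟩
      exact ⟨_, hF g x⟩
    · obtain ⟨w, hw⟩ := exists_ne (0 : W)
      refine hw (hinj ?_)
      rw [map_zero, ← hFj]
      exact (Submodule.mem_bot ℂ).1 (h.le ⟨_, rfl⟩)
  let e := LinearEquiv.ofBijective F ⟨LinearMap.ker_eq_bot.1 hker, LinearMap.range_eq_top.1 hrange⟩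
  refine nonempty_equiv_of_linearEquiv e.symm fun g v => ?_
  rw [LinearEquiv.symm_apply_eq]
  exact ((hF g (e.symm v)).trans (congrArg (ρ g) (e.apply_symm_apply v))).symm

omit hN hτ [Finite G] in
/-- The weight space of an irreducible representation is irreducible under the stabilizer of the
weight. -/
theorem IsIrreducible.eq_bot_or_eq_weightSpace (hirr : ρ.IsIrreducible) {p : Submodule ℂ V}
    (hp : p ≤ ρ.weightSpace χ) (hpI : ∀ g ∈ I, ∀ v ∈ p, ρ g v ∈ p) :
    p = ⊥ ∨ p = ρ.weightSpace χ := by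
  classical
  rw [isIrreducible_iff_forall_submodule] at hirr
  set q := Submodule.span ℂ {x | ∃ g, ∃ v ∈ p, x = ρ g v} with hq
  have hqp : q ≤ p.comap (ρ.weightProj χ) := by
    rw [hq, Submodule.span_le]
    rintro _ ⟨g, v, hv, rfl⟩
    rw [SetLike.mem_coe, Submodule.mem_comap]
    by_cases hg : g ∈ I
    · rw [weightProj_apply_of_mem (apply_mem_weightSpace hI hg (hp hv))]
      exact hpI g hg v hv
    · rw [weightProj_apply_of_notMem hI hg (hp hv)]
      exact p.zero_mem
  refine (hirr.2 q fun g => ?_).imp (fun h => ?_) (fun h => ?_)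
  · suffices q ≤ q.comap (ρ g) from fun v hv => this hv
    conv_lhs => rw [hq]
    rw [Submodule.span_le]
    rintro _ ⟨h, v, hv, rfl⟩
    refine Submodule.subset_span ⟨g * h, v, hv, ?_⟩
    rw [map_mul, Module.End.mul_apply]
  · rw [eq_bot_iff, ← h]
    exact fun v hv => Submodule.subset_span ⟨1, v, hv, by simp⟩
  · refine le_antisymm hp fun v hv => ?_
    rw [← weightProj_apply_of_mem hv]
    exact hqp (h.ge Submodule.mem_top)

omit [Finite G] in
/-- The inducing representation is recovered as the `χ`-weight space. -/
theorem nonempty_equiv_of_ind {W' : Type*} [AddCommGroup W'] [Module ℂ W']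
    {τ' : Representation ℂ I W'}
    (hτ' : ∀ (n : N) w, τ' (Subgroup.inclusion hN n) w = (χ n : ℂ) • w)
    (e : (Representation.ind I.subtype τ).Equiv (Representation.ind I.subtype τ')) :
    Nonempty (τ.Equiv τ') := by
  have h1 : ∀ w, ∃ w', indIncl τ' w' = e.toLinearEquiv (indIncl τ w) := fun w => by
    rw [← mem_weightSpace_ind_iff hN hI hτ']
    intro n
    rw [← Equiv.apply_apply, ← map_smul]
    exact congrArg _ (indIncl_mem_weightSpace hN hτ w n)
  choose f hf using h1
  have hinj := indIncl_injective τ'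
  let F : W →ₗ[ℂ] W' :=
    { toFun := f
      map_add' := fun a b => hinj (by simp only [hf, map_add])
      map_smul' := fun c a => hinj (by simp only [hf, map_smul, RingHom.id_apply]) }
  have hF : Function.Bijective F := by
    constructor
    · intro a b hab
      have : f a = f b := hab
      refine indIncl_injective τ (e.toLinearEquiv.injective ?_)
      rw [← hf, ← hf, this]
    · intro w'
      have : e.toLinearEquiv.symm (indIncl τ' w') ∈
          (Representation.ind I.subtype τ).weightSpace χ := fun n => by
        apply e.toLinearEquiv.injective
        rw [Equiv.apply_apply, map_smul, LinearEquiv.apply_symm_apply]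
        exact indIncl_mem_weightSpace hN hτ' w' n
      obtain ⟨w, hw⟩ := (mem_weightSpace_ind_iff hN hI hτ).1 this
      refine ⟨w, hinj ?_⟩
      show indIncl τ' (f w) = _
      rw [hf, hw, LinearEquiv.apply_symm_apply]
  refine nonempty_equiv_of_linearEquiv (LinearEquiv.ofBijective F hF) fun i w => hinj ?_
  show indIncl τ' (f (τ i w)) = indIncl τ' (τ' i (f w))
  rw [hf, ← ind_apply_indIncl_of_mem, ← ind_apply_indIncl_of_mem, hf, Equiv.apply_apply]

end StableCharacter

end Representation

/-! ### Isometries of symplectic spaces over the field with two elements -/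

section Isometry

variable {V : Type*} [AddCommGroup V] [Module (ZMod 2) V] (ω : LinearMap.BilinForm (ZMod 2) V)

theorem ZMod.eq_zero_or_eq_one_of_two (a : ZMod 2) : a = 0 ∨ a = 1 := by
  revert a; decide

theorem ZMod.add_self_two {M : Type*} [AddCommGroup M] [Module (ZMod 2) M] (x : M) :
    x + x = 0 := by
  rw [← two_smul (ZMod 2) x, show (2 : ZMod 2) = 0 from rfl, zero_smul]

/-- The transvection `x ↦ x + ω(x, a) a`. -/
def symplTransvection (a : V) : V →ₗ[ZMod 2] V :=
  LinearMap.id + (ω.flip a).smulRight a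

theorem symplTransvection_apply (a x : V) : symplTransvection ω a x = x + ω x a • a := rfl

variable {ω}

theorem symplTransvection_of_eq_zero {a x : V} (h : ω x a = 0) :
    symplTransvection ω a x = x := by
  rw [symplTransvection_apply, h, zero_smul, add_zero]

theorem symplTransvection_of_eq_one {a x : V} (h : ω x a = 1) :
    symplTransvection ω a x = x + a := by
  rw [symplTransvection_apply, h, one_smul]

theorem symplTransvection_self (hω : ω.IsAlt) (a x : V) :
    symplTransvection ω a (symplTransvection ω a x) = x := by
  have h : symplTransvection ω a a = a := symplTransvection_of_eq_zero (hω a)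
  rw [symplTransvection_apply ω a x, map_add, map_smul, h, symplTransvection_apply, add_assoc,
    ZMod.add_self_two, add_zero]

theorem LinearMap.BilinForm.IsAlt.eq_swap (hω : ω.IsAlt) (x y : V) : ω x y = ω y x := by
  rw [← hω.neg_eq, ZMod.neg_eq_self_mod_two]

theorem symplTransvection_isometry (hω : ω.IsAlt) (a x y : V) :
    ω (symplTransvection ω a x) (symplTransvection ω a y) = ω x y := by
  simp only [symplTransvection_apply, map_add, map_smul, LinearMap.add_apply, LinearMap.smul_apply,
    hω a, smul_eq_mul, mul_zero, add_zero, hω.eq_swap a y]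
  rw [add_assoc, mul_comm (ω x a), ZMod.add_self_two, add_zero]

/-- Induction principle: the isometries of a finite symplectic space that fix a vector `v` are the
products of the transvections along the vectors orthogonal to `v`.

If `f` is an isometry and `a = f x + x`, then the transvection along `a` fixes every fixed point
of `f`; if moreover `ω(x, f x) = 1`, it sends `f x` to `x`, so that composing it with `f` enlarges
the set of fixed points. If `ω(x, f x) = 0` for all `x`, composing first with some transvection of
this kind produces such an `x`. -/
theorem isometry_induction [Finite V] (hω : ω.IsAlt) (hnd : ∀ a, (∀ x, ω x a = 0) → a = 0) (v : V)
    {P : (V →ₗ[ZMod 2] V) → Prop} (one : P LinearMap.id)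
    (step : ∀ a f, ω v a = 0 → P f → P (symplTransvection ω a ∘ₗ f))
    (f : V →ₗ[ZMod 2] V) (hf : ∀ x y, ω (f x) (f y) = ω x y) (hv : f v = v) : P f := by
  classical
  -- the vector `f x + x` is orthogonal to every fixed point of `f`
  have hfix : ∀ (f : V →ₗ[ZMod 2] V), (∀ x y, ω (f x) (f y) = ω x y) → ∀ x y, f y = y →
      ω y (f x + x) = 0 := fun f hf x y hy => by
    rw [map_add, ← hf y x, hy, ZMod.add_self_two]
  have hcomp : ∀ (f : V →ₗ[ZMod 2] V), (∀ x y, ω (f x) (f y) = ω x y) → ∀ a x y,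
      ω ((symplTransvection ω a ∘ₗ f) x) ((symplTransvection ω a ∘ₗ f) y) = ω x y :=
    fun f hf a x y => (symplTransvection_isometry hω a _ _).trans (hf x y)
  have hback : ∀ a (f : V →ₗ[ZMod 2] V), ω v a = 0 → P (symplTransvection ω a ∘ₗ f) → P f :=
    fun a f ha h => by
      have := step a _ ha h
      rwa [← LinearMap.comp_assoc, show symplTransvection ω a ∘ₗ symplTransvection ω a =
        LinearMap.id from LinearMap.ext (symplTransvection_self hω a), LinearMap.id_comp] at this
  -- induction on the number of moved points
  induction hm : Nat.card {x // f x ≠ x} using Nat.strong_induction_on generalizing f with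
  | _ m ih =>
  -- it suffices to find `g`, fixing what `f` fixes, with some `ω(x, g x) = 1`
  have main : ∀ g : V →ₗ[ZMod 2] V, (∀ x y, ω (g x) (g y) = ω x y) → (∀ x, f x = x → g x = x) →
      (∃ x, ω x (g x) = 1) → P g := by
    rintro g hg hfg ⟨x, hx⟩
    refine hback (g x + x) g (hfix g hg x v (hfg v hv)) ?_
    have hfg' : ∀ y, f y = y → (symplTransvection ω (g x + x) ∘ₗ g) y = y := fun y hy => by
      rw [LinearMap.comp_apply, hfg y hy]
      exact symplTransvection_of_eq_zero (hfix g hg x y (hfg y hy))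
    have hgx : (symplTransvection ω (g x + x) ∘ₗ g) x = x := by
      rw [LinearMap.comp_apply, symplTransvection_of_eq_one, ← add_assoc, ZMod.add_self_two,
        zero_add]
      rw [map_add, hω, zero_add, hω.eq_swap, hx]
    have hxf : f x ≠ x := fun h => by
      rw [hfg x h, hω] at hx
      exact zero_ne_one hx
    refine ih _ ?_ _ (hcomp g hg _) (hfg' v hv) rfl
    rw [← hm]
    refine Set.ncard_lt_ncard (s := {y | _ ≠ y}) (t := {y | f y ≠ y}) ⟨fun y hy h => hy (hfg' y h),
      fun h => ?_⟩ (Set.toFinite _)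
    exact h hxf hgx
  by_cases h : ∃ x, ω x (f x) = 1
  · exact main f hf (fun _ => id) h
  have h0 : ∀ x, ω x (f x) = 0 := fun x =>
    (ZMod.eq_zero_or_eq_one_of_two _).resolve_right fun hx => h ⟨x, hx⟩
  by_cases h1 : ∀ x, f x = x
  · rwa [show f = LinearMap.id from LinearMap.ext h1]
  push Not at h1
  obtain ⟨x₀, hx₀⟩ := h1
  have hpolar : ∀ x y, ω x (f y) = ω y (f x) := fun x y => by
    have := h0 (x + y)
    simp only [map_add, LinearMap.add_apply, h0, zero_add, add_zero] at this
    rw [← sub_eq_zero, CharTwo.sub_eq_add, add_comm]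
    exact this
  have ha : f x₀ + x₀ ≠ 0 := fun h => hx₀ (by
    rw [← add_zero (f x₀), ← ZMod.add_self_two x₀, ← add_assoc, h, zero_add])
  obtain ⟨x, hx⟩ : ∃ x, ω x (f x₀ + x₀) = 1 := by
    by_contra! hx
    exact ha (hnd _ fun x => (ZMod.eq_zero_or_eq_one_of_two _).resolve_right (hx x))
  refine hback (f x₀ + x₀) f (hfix f hf x₀ v hv) (main _ (hcomp f hf _) (fun y hy => ?_) ⟨x, ?_⟩)
  · rw [LinearMap.comp_apply, hy]
    exact symplTransvection_of_eq_zero (hfix f hf x₀ y hy)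
  · have : ω (f x) (f x₀ + x₀) = 1 := by
      rw [← hx, map_add, map_add, hf, hω.eq_swap (f x), ← hpolar x, add_comm]
    rw [LinearMap.comp_apply, symplTransvection_of_eq_one this, map_add, h0, zero_add, hx]

/-- For two nonzero vectors of a symplectic space over `ZMod 2`, some vector has pairing `1` with
both. -/
theorem exists_eq_one_eq_one (hnd : ∀ a, (∀ x, ω x a = 0) → a = 0) {a b : V} (ha : a ≠ 0)
    (hb : b ≠ 0) : ∃ z, ω z a = 1 ∧ ω z b = 1 := by
  have key : ∀ c : V, c ≠ 0 → ∃ z, ω z c = 1 := fun c hc => by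
    by_contra! h
    exact hc (hnd c fun x => (ZMod.eq_zero_or_eq_one_of_two _).resolve_right (h x))
  obtain ⟨y, hy⟩ := key a ha
  obtain ⟨z, hz⟩ := key b hb
  rcases ZMod.eq_zero_or_eq_one_of_two (ω y b) with h | h
  · rcases ZMod.eq_zero_or_eq_one_of_two (ω z a) with h' | h'
    · exact ⟨y + z, by simp [hy, h'], by simp [hz, h]⟩
    · exact ⟨z, h', hz⟩
  · exact ⟨y, hy, h⟩

/-- A set of vectors that contains `b + c` whenever it contains `b` and `ω(b, c) = 1` contains all
the nonzero vectors as soon as it contains one. -/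
theorem mem_of_forall_add_mem (hω : ω.IsAlt) (hnd : ∀ a, (∀ x, ω x a = 0) → a = 0) {S : Set V}
    (hS : ∀ b ∈ S, ∀ c, ω b c = 1 → b + c ∈ S) {a b : V} (ha : a ≠ 0) (hb : b ≠ 0) (haS : a ∈ S) :
    b ∈ S := by
  have key : ∀ x ∈ S, ∀ y, ω x y = 1 → y ∈ S := fun x hx y hxy => by
    have := hS x hx (x + y) (by rw [map_add, hω, zero_add, hxy])
    rwa [← add_assoc, ZMod.add_self_two, zero_add] at this
  obtain ⟨z, hza, hzb⟩ := exists_eq_one_eq_one hnd ha hb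
  exact key z (key a haS z (by rw [hω.eq_swap, hza])) b hzb

end Isometry

/-! ### The standard symplectic form over the field with two elements -/

/-- Pairs `(p, q)` of vectors of length `n` over `ZMod 2`. -/
abbrev SymplVec (n : ℕ) : Type := Fin n ⊕ Fin n → ZMod 2

/-- The standard symplectic form `((p, q), (p', q')) ↦ p · q' + q · p'`. -/
def symplForm (n : ℕ) : LinearMap.BilinForm (ZMod 2) (SymplVec n) :=
  LinearMap.mk₂ (ZMod 2)
    (fun x y => ∑ i, (x (Sum.inl i) * y (Sum.inr i) + x (Sum.inr i) * y (Sum.inl i)))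
    (fun x x' y => by
      rw [← Finset.sum_add_distrib]
      exact Finset.sum_congr rfl fun i _ => by simp only [Pi.add_apply]; ring)
    (fun c x y => by
      rw [smul_eq_mul, Finset.mul_sum]
      exact Finset.sum_congr rfl fun i _ => by simp only [Pi.smul_apply, smul_eq_mul]; ring)
    (fun x y y' => by
      rw [← Finset.sum_add_distrib]
      exact Finset.sum_congr rfl fun i _ => by simp only [Pi.add_apply]; ring)
    (fun c x y => by
      rw [smul_eq_mul, Finset.mul_sum]
      exact Finset.sum_congr rfl fun i _ => by simp only [Pi.smul_apply, smul_eq_mul]; ring)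

theorem symplForm_apply {n : ℕ} (x y : SymplVec n) :
    symplForm n x y = ∑ i, (x (Sum.inl i) * y (Sum.inr i) + x (Sum.inr i) * y (Sum.inl i)) := rfl

theorem symplForm_isAlt (n : ℕ) : (symplForm n).IsAlt := fun x => by
  rw [symplForm_apply]
  exact Finset.sum_eq_zero fun i _ => by
    rw [mul_comm (x (Sum.inr i)), ZMod.add_self_two]

theorem symplForm_single_inl {n : ℕ} (i : Fin n) (y : SymplVec n) :
    symplForm n (Pi.single (Sum.inl i) 1) y = y (Sum.inr i) := by
  rw [symplForm_apply, Finset.sum_eq_single i]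
  · simp
  · intro j _ hj
    simp [hj]
  · simp

theorem symplForm_single_inr {n : ℕ} (i : Fin n) (y : SymplVec n) :
    symplForm n (Pi.single (Sum.inr i) 1) y = y (Sum.inl i) := by
  rw [symplForm_apply, Finset.sum_eq_single i]
  · simp
  · intro j _ hj
    simp [hj]
  · simp

theorem symplForm_nondegenerate {n : ℕ} (a : SymplVec n) (h : ∀ x, symplForm n x a = 0) :
    a = 0 := by
  funext i
  cases i with
  | inl i => exact (symplForm_single_inr i a).symm.trans (h _)
  | inr i => exact (symplForm_single_inl i a).symm.trans (h _)

theorem mem_symplecticGroup_iff_symplForm {n : ℕ}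
    (A : Matrix (Fin n ⊕ Fin n) (Fin n ⊕ Fin n) (ZMod 2)) :
    A ∈ Matrix.symplecticGroup (Fin n) (ZMod 2) ↔
      ∀ x y, symplForm n (A *ᵥ x) (A *ᵥ y) = symplForm n x y := by
  have hJ : ∀ x y : SymplVec n, symplForm n x y = x ⬝ᵥ (Matrix.J (Fin n) (ZMod 2) *ᵥ y) := by
    intro x y
    rw [symplForm_apply, Matrix.J, Matrix.fromBlocks_mulVec]
    simp [dotProduct, Fintype.sum_sum_type, Finset.sum_add_distrib, Matrix.neg_mulVec,
      ZMod.neg_eq_self_mod_two]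
  rw [SymplecticGroup.mem_iff']
  simp only [hJ]
  have hA : ∀ x y : SymplVec n, A *ᵥ x ⬝ᵥ (Matrix.J (Fin n) (ZMod 2) *ᵥ (A *ᵥ y)) =
      x ⬝ᵥ ((Aᵀ * Matrix.J (Fin n) (ZMod 2) * A) *ᵥ y) := fun x y => by
    rw [Matrix.mul_assoc, ← Matrix.mulVec_mulVec, ← Matrix.mulVec_mulVec,
      Matrix.dotProduct_mulVec x, Matrix.vecMul_transpose]
  simp only [hA]
  constructor
  · intro h x y
    rw [h]
  · intro h
    ext i j
    simpa using h (Pi.single i 1) (Pi.single j 1)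

/-! ### Weyl operators -/

/-- The nontrivial additive character `a ↦ (-1) ^ a` of `ZMod 2`. -/
def signChar : AddChar (ZMod 2) ℂ where
  toFun a := (-1) ^ a.val
  map_zero_eq_one' := by simp
  map_add_eq_mul' := by
    intro a b
    rw [← pow_add]
    refine neg_one_pow_congr ?_
    revert a b
    decide

theorem signChar_one : signChar 1 = -1 := by
  show (-1 : ℂ) ^ (1 : ZMod 2).val = -1
  rw [ZMod.val_one, pow_one]

theorem signChar_injective : Function.Injective signChar := by
  intro a b h
  rcases ZMod.eq_zero_or_eq_one_of_two a with rfl | rfl <;>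
    rcases ZMod.eq_zero_or_eq_one_of_two b with rfl | rfl <;>
    simp [signChar_one] at h ⊢ <;> norm_num [eq_neg_iff_add_eq_zero, neg_eq_iff_add_eq_zero] at h

theorem signChar_eq_or (a : ZMod 2) : signChar a = 1 ∨ signChar a = -1 := by
  rcases ZMod.eq_zero_or_eq_one_of_two a with rfl | rfl
  · exact Or.inl signChar.map_zero_eq_one
  · exact Or.inr signChar_one

theorem signChar_mul_self (a : ZMod 2) : signChar a * signChar a = 1 := by
  rw [← AddChar.map_add_eq_mul, ZMod.add_self_two, AddChar.map_zero_eq_one]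

theorem signChar_sum {ι : Type*} (s : Finset ι) (f : ι → ZMod 2) :
    signChar (∑ i ∈ s, f i) = ∏ i ∈ s, signChar (f i) := by
  classical
  induction s using Finset.induction_on with
  | empty => simp
  | insert a s ha ih => rw [Finset.sum_insert ha, Finset.prod_insert ha, AddChar.map_add_eq_mul, ih]

theorem signChar_ne_zero (a : ZMod 2) : signChar a ≠ 0 := fun h => by
  have := signChar_mul_self a
  rw [h, zero_mul] at this
  exact zero_ne_one this

/-- The one-qubit Weyl operator `Z ^ p * X ^ q`. -/
def weylOne (p q : ZMod 2) : Matrix (Fin 2) (Fin 2) ℂ := pauliZ.1 ^ p.val * pauliX.1 ^ q.val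

/-- The label of a one-qubit basis vector, as an element of `ZMod 2`. -/
def qubitLabel (a : Fin 2) : ZMod 2 := a

theorem qubitLabel_injective : Function.Injective qubitLabel := fun _ _ h => h

theorem weylOne_apply (p q : ZMod 2) (a b : Fin 2) :
    weylOne p q a b =
      if qubitLabel a = qubitLabel b + q then signChar (p * qubitLabel a) else 0 := by
  have h0 : ZMod.val (0 : ZMod 2) = 0 := rfl
  have h1 : ZMod.val (1 : ZMod 2) = 1 := rfl
  have h2 : qubitLabel 0 = 0 := rfl
  have h3 : qubitLabel 1 = 1 := rfl
  have h4 : (1 : ZMod 2) + 1 = 0 := rfl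
  rcases ZMod.eq_zero_or_eq_one_of_two p with rfl | rfl <;>
    rcases ZMod.eq_zero_or_eq_one_of_two q with rfl | rfl <;>
    fin_cases a <;> fin_cases b <;>
    simp [weylOne, h0, h1, h2, h3, h4, pauliX, pauliZ, signChar_one]

theorem weylOne_mul (p q p' q' : ZMod 2) :
    weylOne p q * weylOne p' q' = signChar (q * p') • weylOne (p + p') (q + q') := by
  have h2 : qubitLabel 0 = 0 := rfl
  have h3 : qubitLabel 1 = 1 := rfl
  have h4 : (1 : ZMod 2) + 1 = 0 := rfl
  ext a b
  rw [Matrix.mul_apply, Fin.sum_univ_two]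
  simp only [Matrix.smul_apply, weylOne_apply, smul_eq_mul]
  rcases ZMod.eq_zero_or_eq_one_of_two p with rfl | rfl <;>
    rcases ZMod.eq_zero_or_eq_one_of_two q with rfl | rfl <;>
    rcases ZMod.eq_zero_or_eq_one_of_two p' with rfl | rfl <;>
    rcases ZMod.eq_zero_or_eq_one_of_two q' with rfl | rfl <;>
    fin_cases a <;> fin_cases b <;> simp [h2, h3, h4, signChar_one]

theorem weylOne_conjTranspose (p q : ZMod 2) :
    star (weylOne p q) = signChar (p * q) • weylOne p q := by
  have h2 : qubitLabel 0 = 0 := rfl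
  have h3 : qubitLabel 1 = 1 := rfl
  have h4 : (1 : ZMod 2) + 1 = 0 := rfl
  ext a b
  simp only [Matrix.star_apply, Matrix.smul_apply, weylOne_apply, smul_eq_mul]
  rcases ZMod.eq_zero_or_eq_one_of_two p with rfl | rfl <;>
    rcases ZMod.eq_zero_or_eq_one_of_two q with rfl | rfl <;>
    fin_cases a <;> fin_cases b <;> simp [h2, h3, h4, signChar_one]

theorem tensor_smul {n : ℕ} (c : Fin n → ℂ) (A : Fin n → Matrix (Fin 2) (Fin 2) ℂ) :
    tensor (fun i => c i • A i) = (∏ i, c i) • tensor A := by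
  ext x y
  simp [tensor, Finset.prod_mul_distrib]

section Weyl

variable {n : ℕ}

theorem weyl_val (x : SymplVec n) :
    (weyl x).1 = tensor fun i => weylOne (x (Sum.inl i)) (x (Sum.inr i)) := rfl

theorem weyl_mul (x y : SymplVec n) :
    (weyl x).1 * (weyl y).1 =
      signChar (∑ i, x (Sum.inr i) * y (Sum.inl i)) • (weyl (x + y)).1 := by
  rw [weyl_val, weyl_val, weyl_val, ← tensor_mul, signChar_sum, ← tensor_smul]
  congr 1
  funext i
  exact weylOne_mul _ _ _ _

/-- The symplectic form of the labels records the commutation sign of Weyl operators. -/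
theorem weyl_comm (x y : SymplVec n) :
    (weyl x).1 * (weyl y).1 = signChar (symplForm n x y) • ((weyl y).1 * (weyl x).1) := by
  rw [weyl_mul, weyl_mul, smul_smul, add_comm y x, ← AddChar.map_add_eq_mul]
  congr 2
  rw [symplForm_apply, ← Finset.sum_add_distrib]
  refine Finset.sum_congr rfl fun i _ => ?_
  rw [mul_comm (y _), add_comm (x _ * y _), add_assoc, ZMod.add_self_two, add_zero]

theorem weyl_zero : weyl (0 : SymplVec n) = 1 := by
  refine Subtype.ext ?_
  rw [weyl_val]
  refine Eq.trans ?_ tensor_one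
  congr 1
  funext i
  simp [weylOne]

theorem weyl_mul_self (x : SymplVec n) :
    (weyl x).1 * (weyl x).1 = signChar (∑ i, x (Sum.inr i) * x (Sum.inl i)) • 1 := by
  rw [weyl_mul, ZMod.add_self_two, weyl_zero]
  rfl

theorem unitary_ne_zero {ι : Type*} [Fintype ι] [DecidableEq ι] [Nonempty ι]
    (U : Matrix.unitaryGroup ι ℂ) : U.1 ≠ 0 := fun h => by
  have := Matrix.mem_unitaryGroup_iff.1 U.2
  rw [h, zero_mul] at this
  exact zero_ne_one this

theorem signChar_smul_unitary_injective {ι : Type*} [Fintype ι] [DecidableEq ι] [Nonempty ι]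
    (U : Matrix.unitaryGroup ι ℂ) {a b : ZMod 2} (h : signChar a • U.1 = signChar b • U.1) :
    a = b :=
  signChar_injective (smul_left_injective ℂ (unitary_ne_zero U) h)

/-- Weyl operators with distinct labels are not proportional: a label is determined by the signs
in the commutation relations. -/
theorem eq_of_weyl_eq_smul {x y : SymplVec n} {c : ℂ} (h : (weyl x).1 = c • (weyl y).1) :
    x = y := by
  rw [← sub_eq_zero]
  refine symplForm_nondegenerate _ fun z => ?_
  rw [map_sub, sub_eq_zero]
  refine signChar_smul_unitary_injective (weyl x * weyl z) ?_
  show _ • ((weyl x).1 * (weyl z).1) = _ • ((weyl x).1 * (weyl z).1)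
  rw [← weyl_comm, h, Matrix.mul_smul, Matrix.smul_mul, weyl_comm z y, smul_comm]

theorem exists_eq_smul_weylOne {P : Matrix.unitaryGroup (Fin 2) ℂ} (hP : P ∈ pauliOne) :
    ∃ (c : ℂ) (p q : ZMod 2), P.1 = c • weylOne p q := by
  have h1 : ZMod.val (1 : ZMod 2) = 1 := rfl
  induction hP using Subgroup.closure_induction with
  | mem x hx =>
    rcases hx with rfl | rfl | rfl
    · exact ⟨1, 0, 1, by simp [weylOne, h1]⟩
    · exact ⟨1, 1, 0, by simp [weylOne, h1]⟩
    · refine ⟨Complex.I, 0, 0, ?_⟩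
      ext i j
      fin_cases i <;> fin_cases j <;> simp [weylOne, phaseI]
  | one => exact ⟨1, 0, 0, by simp [weylOne]⟩
  | mul x y _ _ hx hy =>
    obtain ⟨c, p, q, hx⟩ := hx
    obtain ⟨c', p', q', hy⟩ := hy
    refine ⟨c * c' * signChar (q * p'), p + p', q + q', ?_⟩
    show x.1 * y.1 = _
    rw [hx, hy, Matrix.smul_mul, Matrix.mul_smul, weylOne_mul, smul_smul, smul_smul, mul_assoc]
  | inv x _ hx =>
    obtain ⟨c, p, q, hx⟩ := hx
    refine ⟨star c * signChar (p * q), p, q, ?_⟩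
    show star x.1 = _
    rw [hx, star_smul, weylOne_conjTranspose, smul_smul]

theorem exists_eq_smul_weyl {P : Matrix.unitaryGroup (Qubits n) ℂ} (hP : P ∈ pauliGroup n) :
    ∃ (c : ℂ) (x : SymplVec n), P.1 = c • (weyl x).1 := by
  obtain ⟨p, hp, rfl⟩ := hP
  choose c a b h using fun i => exists_eq_smul_weylOne (hp i (Set.mem_univ i))
  refine ⟨∏ i, c i, Sum.elim a b, ?_⟩
  rw [weyl_val, ← tensor_smul]
  show tensor _ = _
  congr 1
  funext i
  exact h i

theorem weyl_mem_pauliGroup (x : SymplVec n) : weyl x ∈ pauliGroup n := by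
  refine Subgroup.mem_map_of_mem _ ?_
  rw [Subgroup.mem_pi]
  exact fun i _ => mul_mem (pow_mem pZ.2 _) (pow_mem pX.2 _)

theorem weyl_inr_apply (q : Fin n → ZMod 2) (x y : Qubits n) :
    (weyl (Sum.elim 0 q)).1 x y =
      if (fun i => qubitLabel (x i)) = (fun i => qubitLabel (y i)) + q then 1 else 0 := by
  rw [weyl_val]
  simp only [tensor, Matrix.of_apply, weylOne_apply, Sum.elim_inl, Sum.elim_inr, Pi.zero_apply,
    zero_mul, AddChar.map_zero_eq_one]
  split_ifs with h
  · exact Finset.prod_eq_one fun i _ => if_pos (congrFun h i)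
  · obtain ⟨i, hi⟩ := Function.ne_iff.1 h
    exact Finset.prod_eq_zero (Finset.mem_univ i) (if_neg hi)

theorem weyl_inl_eq (p : Fin n → ZMod 2) :
    (weyl (Sum.elim p 0)).1 =
      Matrix.diagonal fun x : Qubits n => ∏ i, signChar (p i * qubitLabel (x i)) := by
  ext x y
  rw [weyl_val]
  simp only [tensor, Matrix.of_apply, weylOne_apply, Sum.elim_inl, Sum.elim_inr, Pi.zero_apply,
    add_zero, Matrix.diagonal_apply]
  split_ifs with h
  · exact Finset.prod_congr rfl fun i _ => if_pos (congrArg qubitLabel (congrFun h i))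
  · obtain ⟨i, hi⟩ := Function.ne_iff.1 h
    exact Finset.prod_eq_zero (Finset.mem_univ i) (if_neg fun h => hi (qubitLabel_injective h))

/-- A matrix commuting with all Weyl operators is scalar: commuting with the `Z_i` makes it
diagonal, and commuting with the `X_i` makes its diagonal constant. -/
theorem eq_smul_one_of_commute_weyl {A : Matrix (Qubits n) (Qubits n) ℂ}
    (h : ∀ x, A * (weyl x).1 = (weyl x).1 * A) : ∃ c : ℂ, A = c • 1 := by
  refine ⟨A 0 0, ?_⟩
  ext x y
  by_cases hxy : x = y
  · subst hxy
    have h0 : ∀ a : Fin 2, qubitLabel a + qubitLabel a = 0 := fun a => ZMod.add_self_two _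
    have h1 := congrFun (congrFun (h (Sum.elim 0 fun i => qubitLabel (x i))) x) 0
    rw [Matrix.mul_apply, Matrix.mul_apply, Finset.sum_eq_single x, Finset.sum_eq_single 0] at h1
    · have h2 : (weyl (Sum.elim 0 fun i => qubitLabel (x i))).1 x 0 = 1 := by
        rw [weyl_inr_apply, if_pos]
        funext i
        exact (zero_add _).symm
      rw [h2, mul_one, one_mul] at h1
      rw [h1, Matrix.smul_apply, Matrix.one_apply_eq, smul_eq_mul, mul_one]
    · intro z _ hz
      rw [weyl_inr_apply, if_neg, zero_mul]
      intro h
      refine hz (funext fun i => qubitLabel_injective ?_)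
      have := congrFun h i
      exact (left_eq_add.1 (this.trans (add_comm _ _)))
    · simp
    · intro z _ hz
      rw [weyl_inr_apply, if_neg, mul_zero]
      intro h
      refine hz (funext fun i => qubitLabel_injective ?_)
      exact (congrFun h i).trans (zero_add _)
    · simp
  · obtain ⟨i, hi⟩ := Function.ne_iff.1 hxy
    have h1 := congrFun (congrFun (h (Sum.elim (Pi.single i 1) 0)) x) y
    rw [weyl_inl_eq, Matrix.mul_diagonal, Matrix.diagonal_mul] at h1
    have h2 : ∀ z : Qubits n,
        ∏ j, signChar ((Pi.single i 1 : Fin n → ZMod 2) j * qubitLabel (z j)) =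
        signChar (qubitLabel (z i)) := fun z => by
      rw [Finset.prod_eq_single i]
      · simp
      · intro j _ hj
        simp [hj]
      · simp
    rw [h2, h2, mul_comm, ← sub_eq_zero, ← sub_mul] at h1
    rw [Matrix.smul_apply, Matrix.one_apply_ne hxy, smul_zero]
    refine (mul_eq_zero.1 h1).resolve_left fun h => hi ?_
    exact (signChar_injective (sub_eq_zero.1 h)).symm

/-- A unitary that commutes up to scalars with all Weyl operators is proportional to a Weyl
operator. -/
theorem exists_eq_smul_weyl_of_commute {U : Matrix.unitaryGroup (Qubits n) ℂ}
    (h : ∀ x, ∃ c : ℂ, U.1 * (weyl x).1 = c • ((weyl x).1 * U.1)) :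
    ∃ (c : ℂ) (a : SymplVec n), U.1 = c • (weyl a).1 := by
  have hs : ∀ x : SymplVec n, ∃ s : ZMod 2, U.1 * (weyl x).1 = signChar s • ((weyl x).1 * U.1) := by
    intro x
    obtain ⟨c, hc⟩ := h x
    have h1 : U.1 * ((weyl x).1 * (weyl x).1) = (c * c) • ((weyl x).1 * (weyl x).1 * U.1) := by
      rw [← mul_assoc, hc, Matrix.smul_mul, mul_assoc, hc, Matrix.mul_smul, smul_smul, mul_assoc]
    rw [weyl_mul_self, Matrix.mul_smul, Matrix.smul_mul, mul_one, one_mul, smul_comm] at h1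
    have h2 := smul_right_injective _ (signChar_ne_zero _) h1
    have h3 : c * c = 1 := by
      refine smul_left_injective ℂ (unitary_ne_zero U) ?_
      simpa using h2.symm
    rcases mul_self_eq_one_iff.1 h3 with rfl | rfl
    · exact ⟨0, by rw [hc, AddChar.map_zero_eq_one]⟩
    · exact ⟨1, by rw [hc, signChar_one]⟩
  choose s hs using hs
  -- `s` is additive, hence equal to `symplForm n a`, where `a` is read off from the unit vectors;
  -- then `weyl a * U` commutes with all Weyl operators
  let a : SymplVec n :=
    Sum.elim (fun i => s (Pi.single (Sum.inr i) 1)) (fun i => s (Pi.single (Sum.inl i) 1))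
  have hadd : ∀ x y, s (x + y) = s x + s y := by
    intro x y
    refine signChar_smul_unitary_injective (weyl (x + y) * U) ?_
    show _ • ((weyl (x + y)).1 * U.1) = _ • ((weyl (x + y)).1 * U.1)
    rw [← hs]
    refine smul_right_injective _ (signChar_ne_zero (∑ i, x (Sum.inr i) * y (Sum.inl i))) ?_
    show _ • _ = _ • _
    rw [← Matrix.mul_smul, ← weyl_mul, smul_comm, ← Matrix.smul_mul, ← weyl_mul, ← mul_assoc, hs,
      Matrix.smul_mul, mul_assoc, hs, Matrix.mul_smul, smul_smul, AddChar.map_add_eq_mul, mul_assoc]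
  have hlin : AddMonoidHom.toZModLinearMap 2 (AddMonoidHom.mk' s hadd) = symplForm n a := by
    refine LinearMap.pi_ext' fun i => LinearMap.ext_ring ?_
    show s (Pi.single i 1) = symplForm n a (Pi.single i 1)
    rw [(symplForm_isAlt n).eq_swap]
    cases i with
    | inl i => rw [symplForm_single_inl]; rfl
    | inr i => rw [symplForm_single_inr]; rfl
  have hsa : ∀ x, s x = symplForm n a x := fun x => LinearMap.congr_fun hlin x
  obtain ⟨c, hc⟩ := eq_smul_one_of_commute_weyl (A := (weyl a).1 * U.1) fun x => by
    rw [mul_assoc, hs, Matrix.mul_smul, ← mul_assoc, weyl_comm, Matrix.smul_mul, smul_smul, hsa,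
      signChar_mul_self, one_smul, mul_assoc]
  refine ⟨signChar (∑ i, a (Sum.inr i) * a (Sum.inl i)) * c, a, ?_⟩
  have h4 : (weyl a).1 * ((weyl a).1 * U.1) = c • (weyl a).1 := by
    rw [hc, Matrix.mul_smul, mul_one]
  rw [← mul_assoc, weyl_mul_self, Matrix.smul_mul, one_mul] at h4
  rw [← smul_smul, ← h4, smul_smul, signChar_mul_self, one_smul]

end Weyl

/-! ### The action of the projective Clifford group on the labels of Weyl operators -/

section Action

variable {n : ℕ}

theorem cls_eq_of_eq_smul {U V : cliff n} {c : ℂ} (h : V.1.1 = c • U.1.1) : cls n U = cls n V := by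
  refine cls_eq_iff.2 ⟨(U : Matrix.unitaryGroup (Qubits n) ℂ)⁻¹ * V, ⟨c, ?_⟩, by simp⟩
  show star U.1.1 * V.1.1 = _
  rw [h, Matrix.mul_smul, Matrix.mem_unitaryGroup_iff'.1 U.1.2]

theorem exists_eq_smul_of_cls_eq {U V : cliff n} (h : cls n U = cls n V) :
    ∃ c : ℂ, V.1.1 = c • U.1.1 := by
  obtain ⟨s, ⟨c, hc⟩, h⟩ := cls_eq_iff.1 h
  refine ⟨c, ?_⟩
  rw [h]
  show U.1.1 * s.1 = _
  rw [hc, Matrix.mul_smul, mul_one]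

/-- The Weyl operator with label `x` as an element of the Clifford group. -/
noncomputable def weylCliff (x : SymplVec n) : cliff n :=
  ⟨weyl x, pauliGroup_le_cliff n (weyl_mem_pauliGroup x)⟩

/-- The class of the Weyl operator with label `x` in the projective Clifford group. -/
noncomputable def weylCls (x : SymplVec n) : ProjCliff n := cls n (weylCliff x)

theorem weylCls_add (x y : SymplVec n) : weylCls (x + y) = weylCls x * weylCls y := by
  rw [weylCls, weylCls, weylCls, ← map_mul]
  refine (cls_eq_of_eq_smul (c := signChar (∑ i, x (Sum.inr i) * y (Sum.inl i))) ?_)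
  exact weyl_mul x y

theorem weylCls_injective : Function.Injective (weylCls (n := n)) := fun x y h => by
  obtain ⟨c, hc⟩ := exists_eq_smul_of_cls_eq h
  exact (eq_of_weyl_eq_smul hc).symm

theorem weylCls_zero : weylCls (0 : SymplVec n) = 1 := by
  have h := weylCls_add (0 : SymplVec n) 0
  rw [add_zero] at h
  exact left_eq_mul.1 h

theorem mem_projPauli_iff {g : ProjCliff n} : g ∈ projPauli n ↔ ∃ x, weylCls x = g := by
  constructor
  · rintro ⟨P, hP, rfl⟩
    obtain ⟨c, x, h⟩ := exists_eq_smul_weyl (Subgroup.mem_subgroupOf.1 hP)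
    exact ⟨x, cls_eq_of_eq_smul h⟩
  · rintro ⟨x, rfl⟩
    exact Subgroup.mem_map_of_mem _ (Subgroup.mem_subgroupOf.2 (weyl_mem_pauliGroup x))

theorem weylCls_mem (x : SymplVec n) : weylCls x ∈ projPauli n := mem_projPauli_iff.2 ⟨x, rfl⟩

theorem exists_weylCls_eq_conj (g : ProjCliff n) (x : SymplVec n) :
    ∃ y, weylCls y = g * weylCls x * g⁻¹ :=
  mem_projPauli_iff.1 ((projPauli_normal n).conj_mem _ (weylCls_mem x) g)

/-- The linear action on labels by which the projective Clifford group permutes the classes of the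
Weyl operators under conjugation. -/
noncomputable def cliffAction (g : ProjCliff n) : SymplVec n →ₗ[ZMod 2] SymplVec n :=
  AddMonoidHom.toZModLinearMap 2 <|
    AddMonoidHom.mk' (fun x => (exists_weylCls_eq_conj g x).choose) fun x y =>
      weylCls_injective <| (exists_weylCls_eq_conj g (x + y)).choose_spec.trans <| by
        rw [weylCls_add (Exists.choose _), (exists_weylCls_eq_conj g x).choose_spec,
          (exists_weylCls_eq_conj g y).choose_spec, weylCls_add]
        group

theorem weylCls_cliffAction (g : ProjCliff n) (x : SymplVec n) :
    weylCls (cliffAction g x) = g * weylCls x * g⁻¹ := (exists_weylCls_eq_conj g x).choose_spec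

theorem cliffAction_mul (g h : ProjCliff n) (x : SymplVec n) :
    cliffAction (g * h) x = cliffAction g (cliffAction h x) :=
  weylCls_injective <| by simp only [weylCls_cliffAction]; group

theorem cliffAction_one (x : SymplVec n) : cliffAction (1 : ProjCliff n) x = x :=
  weylCls_injective <| by simp only [weylCls_cliffAction]; group

theorem cliffAction_inv_apply (g : ProjCliff n) (x : SymplVec n) :
    cliffAction g⁻¹ (cliffAction g x) = x := by
  rw [← cliffAction_mul, inv_mul_cancel, cliffAction_one]

theorem cliffAction_apply_inv (g : ProjCliff n) (x : SymplVec n) :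
    cliffAction g (cliffAction g⁻¹ x) = x := by
  rw [← cliffAction_mul, mul_inv_cancel, cliffAction_one]

theorem cliffAction_weylCls (a x : SymplVec n) : cliffAction (weylCls a) x = x :=
  weylCls_injective <| by
    rw [weylCls_cliffAction, ← weylCls_add, add_comm, weylCls_add, mul_inv_cancel_right]

theorem conj_weyl (U : cliff n) (x : SymplVec n) :
    ∃ c : ℂ, (U * weyl x * U⁻¹ : Matrix.unitaryGroup (Qubits n) ℂ).1 =
      c • (weyl (cliffAction (cls n U) x)).1 := by
  have h := weylCls_cliffAction (cls n U) x
  rw [weylCls, weylCls, ← map_mul, ← map_inv, ← map_mul] at h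
  exact exists_eq_smul_of_cls_eq h

theorem cliffAction_eq_of_conj {U : cliff n} {x y : SymplVec n} {c : ℂ}
    (h : (U * weyl x * U⁻¹ : Matrix.unitaryGroup (Qubits n) ℂ).1 = c • (weyl y).1) :
    cliffAction (cls n U) x = y := by
  refine weylCls_injective ?_
  rw [weylCls_cliffAction, weylCls, weylCls, ← map_mul, ← map_inv, ← map_mul]
  exact (cls_eq_of_eq_smul (c := c) h).symm

/-- Conjugation preserves the commutation sign of two Weyl operators. -/
theorem symplForm_cliffAction (g : ProjCliff n) (x y : SymplVec n) :
    symplForm n (cliffAction g x) (cliffAction g y) = symplForm n x y := by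
  obtain ⟨U, rfl⟩ := cls_surjective n g
  obtain ⟨c, hc⟩ := conj_weyl U x
  obtain ⟨d, hd⟩ := conj_weyl U y
  refine signChar_smul_unitary_injective
    ((U * weyl y * U⁻¹) * (U * weyl x * U⁻¹) : Matrix.unitaryGroup (Qubits n) ℂ) ?_
  have hU : star U.1.1 * U.1.1 = 1 := Matrix.mem_unitaryGroup_iff'.1 U.1.2
  have hmul : ∀ A B : Matrix (Qubits n) (Qubits n) ℂ, (U.1.1 * A * star U.1.1) *
      (U.1.1 * B * star U.1.1) = U.1.1 * (A * B) * star U.1.1 := fun A B => by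
    rw [show U.1.1 * A * star U.1.1 * (U.1.1 * B * star U.1.1) =
      U.1.1 * A * (star U.1.1 * U.1.1) * B * star U.1.1 by simp only [mul_assoc], hU]
    simp only [mul_one, mul_assoc]
  have h1 : (U * weyl x * U⁻¹ : Matrix.unitaryGroup (Qubits n) ℂ).1 *
      (U * weyl y * U⁻¹ : Matrix.unitaryGroup (Qubits n) ℂ).1 = signChar (symplForm n x y) •
      ((U * weyl y * U⁻¹ : Matrix.unitaryGroup (Qubits n) ℂ).1 *
        (U * weyl x * U⁻¹ : Matrix.unitaryGroup (Qubits n) ℂ).1) := by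
    show (U.1.1 * (weyl x).1 * star U.1.1) * (U.1.1 * (weyl y).1 * star U.1.1) = _ •
      ((U.1.1 * (weyl y).1 * star U.1.1) * (U.1.1 * (weyl x).1 * star U.1.1))
    rw [hmul, hmul, weyl_comm, Matrix.mul_smul, Matrix.smul_mul]
  refine Eq.trans ?_ h1
  show _ • (_ * _) = _
  rw [hc, hd, Matrix.smul_mul, Matrix.smul_mul, Matrix.mul_smul, Matrix.mul_smul,
    weyl_comm (cliffAction _ x)]
  simp only [smul_smul]
  congr 1
  ring

/-- A unitary that fixes all labels commutes up to scalars with all Weyl operators, and is therefore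
proportional to one of them. -/
theorem mem_projPauli_iff_cliffAction {g : ProjCliff n} :
    g ∈ projPauli n ↔ ∀ x, cliffAction g x = x := by
  constructor
  · intro h x
    obtain ⟨a, rfl⟩ := mem_projPauli_iff.1 h
    exact cliffAction_weylCls a x
  · intro h
    obtain ⟨U, rfl⟩ := cls_surjective n g
    obtain ⟨c, a, hU⟩ := exists_eq_smul_weyl_of_commute (U := U) fun x => by
      obtain ⟨c, hc⟩ := conj_weyl U x
      rw [h] at hc
      refine ⟨c, ?_⟩
      rw [← Matrix.smul_mul, ← hc]
      exact congrArg Subtype.val (inv_mul_cancel_right (U.1 * weyl x) U.1).symm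
    exact mem_projPauli_iff.2 ⟨a, cls_eq_of_eq_smul hU⟩

/-- The homomorphism from the projective Clifford group to the symplectic group. -/
noncomputable def toSp (n : ℕ) : ProjCliff n →* Sp n where
  toFun g := ⟨LinearMap.toMatrix' (cliffAction g), by
    rw [mem_symplecticGroup_iff_symplForm]
    intro x y
    rw [LinearMap.toMatrix'_mulVec, LinearMap.toMatrix'_mulVec, symplForm_cliffAction]⟩
  map_one' := Subtype.ext <| by
    show LinearMap.toMatrix' _ = 1
    rw [← LinearMap.toMatrix'_one]
    exact congrArg _ (LinearMap.ext cliffAction_one)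
  map_mul' g h := Subtype.ext <| by
    show LinearMap.toMatrix' _ = LinearMap.toMatrix' _ * LinearMap.toMatrix' _
    rw [← LinearMap.toMatrix'_mul]
    exact congrArg _ (LinearMap.ext (cliffAction_mul g h))

theorem toSp_mulVec (g : ProjCliff n) (x : SymplVec n) : (toSp n g).1 *ᵥ x = cliffAction g x :=
  LinearMap.toMatrix'_mulVec _ _

theorem ker_toSp (n : ℕ) : (toSp n).ker = projPauli n := by
  ext g
  rw [MonoidHom.mem_ker, mem_projPauli_iff_cliffAction]
  constructor
  · intro h x
    rw [← toSp_mulVec, h]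
    exact Matrix.one_mulVec x
  · intro h
    refine Subtype.ext ?_
    show LinearMap.toMatrix' _ = 1
    rw [← LinearMap.toMatrix'_one]
    exact congrArg _ (LinearMap.ext h)

instance finite_projPauli (n : ℕ) : Finite (projPauli n) := by
  have : (projPauli n : Set (ProjCliff n)) = Set.range weylCls := by
    ext g
    exact mem_projPauli_iff
  have h : (projPauli n : Set (ProjCliff n)).Finite := this ▸ Set.finite_range _
  exact h.to_subtype

instance finite_projCliff (n : ℕ) : Finite (ProjCliff n) := by
  have h1 : Finite (ProjCliff n ⧸ (toSp n).ker) :=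
    Finite.of_injective _ (QuotientGroup.kerLift_injective (toSp n))
  rw [ker_toSp] at h1
  exact Finite.of_equiv _ (Subgroup.groupEquivQuotientProdSubgroup (s := projPauli n)).symm

end Action

/-! ### Clifford unitaries acting as transvections -/

section Transvection

variable {n : ℕ}

theorem inv_sqrt_two_mul_self :
    (((Real.sqrt 2 : ℝ) : ℂ)⁻¹ * ((Real.sqrt 2 : ℝ) : ℂ)⁻¹) = 2⁻¹ := by
  rw [← mul_inv, ← Complex.ofReal_mul, Real.mul_self_sqrt (by norm_num)]
  norm_num

theorem star_eq_neg_of_mul_self {P : Matrix.unitaryGroup (Qubits n) ℂ} (hP : P.1 * P.1 = -1) :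
    star P.1 = -P.1 := by
  have h := Matrix.mem_unitaryGroup_iff'.1 P.2
  calc star P.1 = -(star P.1 * (P.1 * P.1)) := by rw [hP]; simp
    _ = -P.1 := by rw [← mul_assoc, h, one_mul]

/-- The unitary `(1 + P) / √2` attached to a unitary `P` with `P² = -1`. -/
noncomputable def pauliRotation (P : Matrix.unitaryGroup (Qubits n) ℂ) (hP : P.1 * P.1 = -1) :
    Matrix.unitaryGroup (Qubits n) ℂ :=
  ⟨((Real.sqrt 2 : ℝ) : ℂ)⁻¹ • (1 + P.1), by
    rw [Matrix.mem_unitaryGroup_iff, star_smul, star_add, star_one, star_eq_neg_of_mul_self hP,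
      Matrix.smul_mul, Matrix.mul_smul, smul_smul]
    have h1 : (1 + P.1) * (1 + -P.1) = (2 : ℂ) • 1 := by
      rw [add_mul, mul_add, mul_add, mul_neg, mul_neg, hP, two_smul]
      simp
    have h2 : star ((Real.sqrt 2 : ℝ) : ℂ)⁻¹ = ((Real.sqrt 2 : ℝ) : ℂ)⁻¹ := by
      rw [star_inv₀]
      exact congrArg _ (Complex.conj_ofReal _)
    rw [h1, h2, inv_sqrt_two_mul_self, smul_smul, inv_mul_cancel₀ two_ne_zero, one_smul]⟩

theorem pauliRotation_val (P : Matrix.unitaryGroup (Qubits n) ℂ) (hP : P.1 * P.1 = -1) :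
    (pauliRotation P hP).1 = ((Real.sqrt 2 : ℝ) : ℂ)⁻¹ • (1 + P.1) := rfl

theorem pauliRotation_conj_of_comm {P Q : Matrix.unitaryGroup (Qubits n) ℂ} (hP : P.1 * P.1 = -1)
    (h : P.1 * Q.1 = Q.1 * P.1) : pauliRotation P hP * Q * (pauliRotation P hP)⁻¹ = Q := by
  rw [mul_inv_eq_iff_eq_mul]
  refine Subtype.ext ?_
  show (pauliRotation P hP).1 * Q.1 = Q.1 * (pauliRotation P hP).1
  rw [pauliRotation_val, Matrix.smul_mul, Matrix.mul_smul, add_mul, mul_add, h, one_mul, mul_one]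

theorem pauliRotation_conj_of_anti {P Q : Matrix.unitaryGroup (Qubits n) ℂ} (hP : P.1 * P.1 = -1)
    (h : P.1 * Q.1 = -(Q.1 * P.1)) : pauliRotation P hP * Q * (pauliRotation P hP)⁻¹ = P * Q := by
  rw [mul_inv_eq_iff_eq_mul]
  refine Subtype.ext ?_
  show (pauliRotation P hP).1 * Q.1 = P.1 * Q.1 * (pauliRotation P hP).1
  have h' : P.1 * Q.1 * P.1 = Q.1 := by
    rw [h, neg_mul, mul_assoc, hP, mul_neg, neg_neg, mul_one]
  rw [pauliRotation_val, Matrix.smul_mul, Matrix.mul_smul, add_mul, mul_add, h', one_mul, mul_one,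
    add_comm]

theorem pauli_comm_or_anti {P Q : Matrix.unitaryGroup (Qubits n) ℂ} (hP : P ∈ pauliGroup n)
    (hQ : Q ∈ pauliGroup n) : P.1 * Q.1 = Q.1 * P.1 ∨ P.1 * Q.1 = -(Q.1 * P.1) := by
  obtain ⟨c, x, hx⟩ := exists_eq_smul_weyl hP
  obtain ⟨d, y, hy⟩ := exists_eq_smul_weyl hQ
  have h : P.1 * Q.1 = signChar (symplForm n x y) • (Q.1 * P.1) := by
    rw [hx, hy, Matrix.smul_mul, Matrix.smul_mul, Matrix.mul_smul, Matrix.mul_smul, weyl_comm]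
    simp only [smul_smul]
    congr 1
    ring
  rcases signChar_eq_or (symplForm n x y) with h' | h'
  · left; rw [h, h', one_smul]
  · right; rw [h, h', neg_one_smul]

theorem pauliRotation_conj_mem {P Q : Matrix.unitaryGroup (Qubits n) ℂ} (hP : P.1 * P.1 = -1)
    (hPm : P ∈ pauliGroup n) (hQ : Q ∈ pauliGroup n) :
    pauliRotation P hP * Q * (pauliRotation P hP)⁻¹ ∈ pauliGroup n := by
  rcases pauli_comm_or_anti hPm hQ with h | h
  · rwa [pauliRotation_conj_of_comm hP h]
  · rw [pauliRotation_conj_of_anti hP h]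
    exact mul_mem hPm hQ

theorem pauliRotation_mem_cliff {P : Matrix.unitaryGroup (Qubits n) ℂ} (hP : P.1 * P.1 = -1)
    (hPm : P ∈ pauliGroup n) : pauliRotation P hP ∈ cliff n := by
  have hP' : (P⁻¹).1 * (P⁻¹).1 = -1 := by
    show star P.1 * star P.1 = -1
    rw [star_eq_neg_of_mul_self hP, neg_mul_neg, hP]
  have hinv : pauliRotation P⁻¹ hP' = (pauliRotation P hP)⁻¹ := by
    rw [eq_inv_iff_mul_eq_one]
    refine Subtype.ext ?_
    show (((Real.sqrt 2 : ℝ) : ℂ)⁻¹ • (1 + star P.1)) * (((Real.sqrt 2 : ℝ) : ℂ)⁻¹ • (1 + P.1)) = 1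
    rw [star_eq_neg_of_mul_self hP, Matrix.smul_mul, Matrix.mul_smul, smul_smul,
      inv_sqrt_two_mul_self, add_mul, mul_add, mul_add, neg_mul, neg_mul, hP]
    have : (1 * 1 + 1 * P.1 + (-(P.1 * 1) + - -1) : Matrix (Qubits n) (Qubits n) ℂ) =
        (2 : ℂ) • 1 := by
      rw [two_smul]
      simp
    rw [this, smul_smul, inv_mul_cancel₀ two_ne_zero, one_smul]
  refine Subgroup.mem_normalizer_iff.2 fun Q => ⟨pauliRotation_conj_mem hP hPm, fun h => ?_⟩
  have h' := pauliRotation_conj_mem hP' (inv_mem hPm) h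
  rw [hinv] at h'
  simpa [mul_assoc] using h'

/-- The unitary `(1 + P) / √2`, for a Pauli operator `P` proportional to the Weyl operator with
label `a`, acts on labels as the transvection along `a`. -/
theorem cliffAction_pauliRotation {P : Matrix.unitaryGroup (Qubits n) ℂ} (hP : P.1 * P.1 = -1)
    (hPm : P ∈ pauliGroup n) {c : ℂ} {a : SymplVec n} (ha : P.1 = c • (weyl a).1) :
    cliffAction (cls n ⟨pauliRotation P hP, pauliRotation_mem_cliff hP hPm⟩) =
      symplTransvection (symplForm n) a := by
  refine LinearMap.ext fun x => ?_
  have h : P.1 * (weyl x).1 = signChar (symplForm n x a) • ((weyl x).1 * P.1) := by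
    rw [ha, Matrix.smul_mul, Matrix.mul_smul, weyl_comm, smul_comm, (symplForm_isAlt n).eq_swap]
  rcases ZMod.eq_zero_or_eq_one_of_two (symplForm n x a) with h0 | h0
  · rw [symplTransvection_of_eq_zero h0]
    refine cliffAction_eq_of_conj (c := 1) ?_
    rw [h0, AddChar.map_zero_eq_one, one_smul] at h
    show (pauliRotation P hP * weyl x * (pauliRotation P hP)⁻¹).1 = _
    rw [pauliRotation_conj_of_comm hP h, one_smul]
  · rw [symplTransvection_of_eq_one h0]
    rw [h0, signChar_one, neg_one_smul] at h
    refine cliffAction_eq_of_conj (c := c * signChar (∑ i, a (Sum.inr i) * x (Sum.inl i))) ?_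
    show (pauliRotation P hP * weyl x * (pauliRotation P hP)⁻¹).1 = _
    rw [pauliRotation_conj_of_anti hP h]
    show P.1 * (weyl x).1 = _
    rw [ha, Matrix.smul_mul, weyl_mul, smul_smul, add_comm]

/-- Every Weyl operator squares to `± 1`, so multiplication by a phase `1` or `i` gives a Pauli
operator with square `-1`. -/
theorem exists_pauli_mul_self_eq_neg_one [NeZero n] (a : SymplVec n) :
    ∃ P ∈ pauliGroup n, P.1 * P.1 = -1 ∧ ∃ c : ℂ, P.1 = c • (weyl a).1 := by
  have hsq := weyl_mul_self a
  rcases signChar_eq_or (∑ i, a (Sum.inr i) * a (Sum.inl i)) with h | h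
  · rw [h, one_smul] at hsq
    -- the Weyl operator has square `1`, and the phase `i` turns this into `-1`
    have hI : (tensorU n (Pi.mulSingle 0 phaseI)).1 = Complex.I • 1 := by
      rw [← tensor_one]
      have : (Complex.I • tensor 1 : Matrix (Qubits n) (Qubits n) ℂ) =
          tensor fun i =>
            (Pi.mulSingle 0 Complex.I : Fin n → ℂ) i • (1 : Matrix (Fin 2) (Fin 2) ℂ) := by
        rw [tensor_smul, Fintype.prod_pi_mulSingle']
        rfl
      rw [this]
      show tensor _ = _
      congr 1
      funext i
      by_cases hi : i = 0
      · subst hi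
        ext a b
        fin_cases a <;> fin_cases b <;> simp [phaseI]
      · simp [Pi.mulSingle_eq_of_ne hi]
    refine ⟨tensorU n (Pi.mulSingle 0 phaseI) * weyl a, mul_mem (Subgroup.mem_map_of_mem _ ?_)
      (weyl_mem_pauliGroup a), ?_, Complex.I, ?_⟩
    · rw [Subgroup.mem_pi]
      intro i _
      by_cases hi : i = 0
      · subst hi
        have h : phaseI ∈ pauliOne := Subgroup.subset_closure (by simp)
        simpa using h
      · simp [Pi.mulSingle_eq_of_ne hi, one_mem]
    · show (_ * (weyl a).1) * (_ * (weyl a).1) = _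
      rw [hI, Matrix.smul_mul, one_mul, Matrix.smul_mul, Matrix.mul_smul, smul_smul, hsq,
        Complex.I_mul_I, neg_one_smul]
    · show _ * (weyl a).1 = _
      rw [hI, Matrix.smul_mul, one_mul]
  · refine ⟨weyl a, weyl_mem_pauliGroup a, ?_, 1, (one_smul _ _).symm⟩
    rw [hsq, h, neg_one_smul]

/-- If a subgroup of the projective Clifford group realizes all transvections along vectors
orthogonal to `v`, then it realizes all isometries that fix `v`. -/
theorem exists_mem_cliffAction_eq {K : Subgroup (ProjCliff n)} {v : SymplVec n}
    (hK : ∀ a, symplForm n v a = 0 → ∃ g ∈ K, cliffAction g = symplTransvection (symplForm n) a)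
    {f : SymplVec n →ₗ[ZMod 2] SymplVec n}
    (hf : ∀ x y, symplForm n (f x) (f y) = symplForm n x y) (hv : f v = v) :
    ∃ g ∈ K, cliffAction g = f := by
  refine isometry_induction (symplForm_isAlt n) symplForm_nondegenerate v
    (P := fun f => ∃ g ∈ K, cliffAction g = f) ⟨1, K.one_mem, LinearMap.ext cliffAction_one⟩ ?_
    f hf hv
  rintro a f ha ⟨g, hg, rfl⟩
  obtain ⟨h, hh, h'⟩ := hK a ha
  exact ⟨h * g, K.mul_mem hh hg, LinearMap.ext fun x => by
    rw [cliffAction_mul, h', LinearMap.comp_apply]⟩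

theorem exists_cliffAction_eq_transvection [NeZero n] (a : SymplVec n) :
    ∃ g : ProjCliff n, cliffAction g = symplTransvection (symplForm n) a := by
  obtain ⟨P, hPm, hP, c, hc⟩ := exists_pauli_mul_self_eq_neg_one a
  exact ⟨_, cliffAction_pauliRotation hP hPm hc⟩

theorem toSp_surjective (n : ℕ) [NeZero n] : Function.Surjective (toSp n) := by
  rintro ⟨A, hA⟩
  obtain ⟨g, -, hg⟩ := exists_mem_cliffAction_eq (K := ⊤) (v := 0) (f := Matrix.toLin' A)
    (fun a _ => by
      obtain ⟨g, hg⟩ := exists_cliffAction_eq_transvection a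
      exact ⟨g, trivial, hg⟩)
    (fun x y => by
      rw [Matrix.toLin'_apply, Matrix.toLin'_apply]
      exact (mem_symplecticGroup_iff_symplForm A).1 hA x y) (map_zero _)
  refine ⟨g, Subtype.ext ?_⟩
  show LinearMap.toMatrix' _ = A
  rw [hg, LinearMap.toMatrix'_toLin']

/-- The symplectic group as the quotient of the projective Clifford group by the projective Pauli
group. -/
noncomputable def quotientProjPauliEquiv (n : ℕ) [NeZero n] :
    (ProjCliff n ⧸ projPauli n) ≃* Sp n :=
  (QuotientGroup.quotientMulEquivOfEq (ker_toSp n).symm).trans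
    (QuotientGroup.quotientKerEquivOfSurjective (toSp n) (toSp_surjective n))

theorem quotientProjPauliEquiv_mk [NeZero n] (g : ProjCliff n) :
    quotientProjPauliEquiv n (QuotientGroup.mk g) = toSp n g := rfl

/-- The projective Clifford group permutes the nonzero labels transitively. -/
theorem exists_cliffAction_apply_eq [NeZero n] {a b : SymplVec n} (ha : a ≠ 0) (hb : b ≠ 0) :
    ∃ g, cliffAction g a = b := by
  refine mem_of_forall_add_mem (S := {b | ∃ g, cliffAction g a = b}) (symplForm_isAlt n)
    symplForm_nondegenerate ?_ ha hb ⟨1, cliffAction_one a⟩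
  rintro _ ⟨g, rfl⟩ c hc
  obtain ⟨h, hh⟩ := exists_cliffAction_eq_transvection c
  exact ⟨h * g, by rw [cliffAction_mul, hh, symplTransvection_of_eq_one hc]⟩

end Transvection

/-! ### Gates on a few qubits -/

section Gates

variable {n : ℕ}

theorem onQubit_apply (j : Fin n) (A : Matrix (Fin 2) (Fin 2) ℂ) (x y : Qubits n) :
    onQubit j A x y = if ∀ i, i ≠ j → x i = y i then A (x j) (y j) else 0 := by
  simp only [onQubit, tensor, Matrix.of_apply]
  split_ifs with h
  · rw [Finset.prod_eq_single j]
    · simp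
    · intro i _ hi
      simp [hi, h i hi]
    · simp
  · push Not at h
    obtain ⟨i, hi, hne⟩ := h
    exact Finset.prod_eq_zero (Finset.mem_univ i) (by simp [hi, hne])

theorem onQubit_mul (j : Fin n) (A B : Matrix (Fin 2) (Fin 2) ℂ) :
    onQubit j A * onQubit j B = onQubit j (A * B) := by
  rw [onQubit, onQubit, onQubit, ← tensor_mul]
  congr 1
  funext i
  by_cases h : i = j
  · subst h; simp
  · simp [h]

theorem onQubit_comm {j k : Fin n} (hjk : j ≠ k) (A B : Matrix (Fin 2) (Fin 2) ℂ) :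
    onQubit j A * onQubit k B = onQubit k B * onQubit j A := by
  rw [onQubit, onQubit, ← tensor_mul, ← tensor_mul]
  congr 1
  funext i
  by_cases h : i = j
  · subst h; simp [hjk]
  · simp [h]

theorem onQubit_one (j : Fin n) : onQubit j 1 = 1 := by
  rw [onQubit, ← tensor_one]
  exact congrArg tensor (Function.update_eq_self j 1)

theorem onQubit_add (j : Fin n) (A B : Matrix (Fin 2) (Fin 2) ℂ) :
    onQubit j (A + B) = onQubit j A + onQubit j B := by
  ext x y
  simp only [Matrix.add_apply, onQubit_apply]
  split_ifs <;> simp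

theorem onQubit_smul (j : Fin n) (c : ℂ) (A : Matrix (Fin 2) (Fin 2) ℂ) :
    onQubit j (c • A) = c • onQubit j A := by
  ext x y
  simp only [Matrix.smul_apply, onQubit_apply]
  split_ifs <;> simp

theorem weyl_single_inl (j : Fin n) : (weyl (Pi.single (Sum.inl j) 1)).1 = onQubit j pauliZ.1 := by
  have h1 : ZMod.val (1 : ZMod 2) = 1 := rfl
  rw [weyl_val, onQubit]
  congr 1
  funext i
  by_cases h : i = j
  · subst h; simp [weylOne, h1]
  · simp [weylOne, h]

theorem weyl_single_inr (j : Fin n) : (weyl (Pi.single (Sum.inr j) 1)).1 = onQubit j pauliX.1 := by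
  have h1 : ZMod.val (1 : ZMod 2) = 1 := rfl
  rw [weyl_val, onQubit]
  congr 1
  funext i
  by_cases h : i = j
  · subst h; simp [weylOne, h1]
  · simp [weylOne, h]

theorem tensorU_mulSingle (j : Fin n) (A : Matrix.unitaryGroup (Fin 2) ℂ) :
    (tensorU n (Pi.mulSingle j A)).1 = onQubit j A.1 := by
  show tensor _ = tensor _
  congr 1
  funext i
  by_cases h : i = j
  · subst h; simp
  · simp [h]

theorem pauliX_mul_self : pauliX.1 * pauliX.1 = 1 := by
  ext a b
  fin_cases a <;> fin_cases b <;> simp [pauliX]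

theorem hadamard_eq : hadamard =
    ((Real.sqrt 2 : ℝ) : ℂ)⁻¹ • (pauliZ.1 * (1 + pauliZ.1 * pauliX.1)) := by
  rw [hadamard]
  congr 1
  ext a b
  fin_cases a <;> fin_cases b <;> simp [pauliX, pauliZ, Matrix.mul_apply]

theorem pauliZ_mul_hadamard : pauliZ.1 * hadamard =
    ((Real.sqrt 2 : ℝ) : ℂ)⁻¹ • (1 + pauliZ.1 * pauliX.1) := by
  rw [hadamard, Matrix.mul_smul]
  congr 1
  ext a b
  fin_cases a <;> fin_cases b <;> simp [pauliX, pauliZ, Matrix.mul_apply]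

/-- The matrix that maps the basis vector `y` to the basis vector `f y`. -/
def basisMap (f : Qubits n → Qubits n) : Matrix (Qubits n) (Qubits n) ℂ :=
  Matrix.of fun x y => if x = f y then 1 else 0

theorem basisMap_mul_apply {f : Qubits n → Qubits n} (hf : Function.Involutive f)
    (B : Matrix (Qubits n) (Qubits n) ℂ) (x y : Qubits n) : (basisMap f * B) x y = B (f x) y := by
  simp only [Matrix.mul_apply, basisMap, Matrix.of_apply]
  rw [Finset.sum_eq_single (f x)]
  · simp [hf x]
  · intro z _ hz
    rw [if_neg (fun h => hz (by rw [h, hf])), zero_mul]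
  · simp

theorem mul_basisMap_apply (f : Qubits n → Qubits n)
    (B : Matrix (Qubits n) (Qubits n) ℂ) (x y : Qubits n) : (B * basisMap f) x y = B x (f y) := by
  simp [Matrix.mul_apply, basisMap]

theorem basisMap_mul (f g : Qubits n → Qubits n) :
    basisMap f * basisMap g = basisMap (f ∘ g) := by
  ext x y
  rw [mul_basisMap_apply]
  rfl

theorem onQubit_pauliX (k : Fin n) :
    onQubit k pauliX.1 = basisMap fun y => Function.update y k (y k + 1) := by
  have hX : ∀ a b : Fin 2, pauliX.1 a b = if a = b + 1 then 1 else 0 := by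
    intro a b
    fin_cases a <;> fin_cases b <;> simp [pauliX]
  ext x y
  rw [onQubit_apply, basisMap, Matrix.of_apply, hX, ← ite_and]
  refine if_congr ?_ rfl rfl
  constructor
  · rintro ⟨h, hk⟩
    funext i
    by_cases hi : i = k
    · subst hi; simpa using hk
    · simp [hi, h i hi]
  · intro h
    rw [h]
    exact ⟨fun i hi => by simp [hi], by simp⟩

theorem ctrlX_eq (j k : Fin n) :
    ctrlX j k = basisMap fun y => Function.update y k (y k + y j) := rfl

section TwoQubits

variable {j k : Fin n} (hjk : j ≠ k)

include hjk

theorem ctrlX_involutive :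
    Function.Involutive fun y : Qubits n => Function.update y k (y k + y j) := by
  have h2 : ∀ a b : Fin 2, a + b + b = a := by decide
  intro y
  simp [hjk, h2]

theorem ctrlX_mul_self : ctrlX j k * ctrlX j k = 1 := by
  rw [ctrlX_eq, basisMap_mul, (ctrlX_involutive hjk).comp_self]
  ext x y
  simp [basisMap, Matrix.one_apply]

theorem ctrlX_mul_target : ctrlX j k * onQubit k pauliX.1 = onQubit k pauliX.1 * ctrlX j k := by
  rw [ctrlX_eq, onQubit_pauliX, basisMap_mul, basisMap_mul]
  congr 1
  funext y
  simp [hjk, add_right_comm]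

/-- Moving the controlled-`X` gate past `Z X` on the control produces an `X` on the target. -/
theorem ctrlX_mul_control : ctrlX j k * onQubit j (pauliZ.1 * pauliX.1) =
    onQubit k pauliX.1 * onQubit j (pauliZ.1 * pauliX.1) * ctrlX j k := by
  have h2 : ∀ a : Fin 2, a + 1 + 1 = a := by decide
  have h3 : ∀ a b c d : Fin 2, c ≠ d → (a + c = b ↔ a + 1 = b + d) := by decide
  have hinv : Function.Involutive fun y : Qubits n => Function.update y k (y k + 1) := fun y => by
    simp [h2]
  have hdiag : ∀ a, (pauliZ.1 * pauliX.1) a a = 0 := by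
    intro a
    fin_cases a <;> simp [pauliX, pauliZ, Matrix.mul_apply]
  ext x y
  rw [ctrlX_eq, basisMap_mul_apply (ctrlX_involutive hjk), onQubit_pauliX, mul_basisMap_apply,
    basisMap_mul_apply hinv, onQubit_apply, onQubit_apply]
  simp only [Function.update_of_ne hjk]
  by_cases hxy : x j = y j
  · rw [hxy, hdiag]
    simp
  · refine if_congr (forall₂_congr fun i hi => ?_) rfl rfl
    by_cases hik : i = k
    · subst hik
      simpa using h3 _ _ _ _ hxy
    · simp [hik]

/-- Conjugating by the controlled-`X` gate shows that `M = (X₂ + Z₁ X₁) / √2`. -/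
theorem gateM_eq : gateM j k = ((Real.sqrt 2 : ℝ) : ℂ)⁻¹ •
    (onQubit k pauliX.1 + onQubit j (pauliZ.1 * pauliX.1)) := by
  have hXX : onQubit k pauliX.1 * onQubit k pauliX.1 = 1 := by
    rw [onQubit_mul, pauliX_mul_self, onQubit_one]
  rw [gateM, onQubit_mul, pauliZ_mul_hadamard, onQubit_smul, onQubit_add, onQubit_one,
    Matrix.smul_mul, Matrix.mul_smul, Matrix.smul_mul]
  congr 1
  rw [add_mul, one_mul, mul_add, add_mul, ctrlX_mul_target hjk, mul_assoc, ctrlX_mul_self hjk,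
    mul_one]
  congr 1
  rw [← mul_assoc, ctrlX_mul_control hjk, mul_assoc _ (ctrlX j k), ctrlX_mul_target hjk,
    ← mul_assoc, mul_assoc _ (ctrlX j k), ctrlX_mul_self hjk, mul_one, mul_assoc, onQubit_comm hjk, ← mul_assoc,
    hXX, one_mul]

end TwoQubits

theorem idTensor_tensor (A : Fin n → Matrix (Fin 2) (Fin 2) ℂ) :
    idTensor (tensor A) = tensor (Fin.cons 1 A : Fin (n + 1) → Matrix (Fin 2) (Fin 2) ℂ) := by
  ext x y
  simp only [idTensor, tensor, Matrix.of_apply, Fin.prod_univ_succ, Fin.cons_zero, Fin.cons_succ,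
    Matrix.one_apply, ite_mul, one_mul, zero_mul]
  rfl

theorem idTensor_smul (c : ℂ) (A : Matrix (Qubits n) (Qubits n) ℂ) :
    idTensor (c • A) = c • idTensor A := by
  ext x y
  simp [idTensor]

theorem idTensor_add (A B : Matrix (Qubits n) (Qubits n) ℂ) :
    idTensor (A + B) = idTensor A + idTensor B := by
  ext x y
  simp only [idTensor, Matrix.of_apply, Matrix.add_apply]
  split_ifs <;> simp

theorem idTensor_one : idTensor (1 : Matrix (Qubits n) (Qubits n) ℂ) = 1 := by
  rw [← tensor_one, idTensor_tensor, ← tensor_one]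
  congr 1
  funext i
  refine Fin.cases rfl (fun i => rfl) i

theorem idTensor_mul_onQubit_zero (A : Matrix (Qubits n) (Qubits n) ℂ)
    (B : Matrix (Fin 2) (Fin 2) ℂ) : idTensor A * onQubit 0 B = onQubit 0 B * idTensor A := by
  have hB : ∀ x y : Qubits (n + 1), onQubit 0 B x y =
      if Fin.tail x = Fin.tail y then B (x 0) (y 0) else 0 := fun x y => by
    rw [onQubit_apply]
    refine if_congr ⟨fun h => funext fun i => h _ (Fin.succ_ne_zero i), fun h i hi => ?_⟩ rfl rfl
    obtain ⟨i, rfl⟩ := Fin.exists_succ_eq.2 hi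
    exact congrFun h i
  ext x y
  simp only [Matrix.mul_apply, hB, idTensor, Matrix.of_apply]
  rw [Finset.sum_eq_single (Fin.cons (x 0) (Fin.tail y) : Qubits (n + 1)),
    Finset.sum_eq_single (Fin.cons (y 0) (Fin.tail x) : Qubits (n + 1))]
  · simp [mul_comm]
  · intro z _ hz
    by_cases h1 : Fin.tail x = Fin.tail z
    · by_cases h2 : z 0 = y 0
      · exact absurd (by rw [h1, ← h2, Fin.cons_self_tail]) hz
      · rw [if_neg h2, mul_zero]
    · rw [if_neg h1, zero_mul]
  · simp
  · intro z _ hz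
    by_cases h1 : Fin.tail z = Fin.tail y
    · by_cases h2 : x 0 = z 0
      · exact absurd (by rw [← h1, h2, Fin.cons_self_tail]) hz
      · rw [if_neg h2, zero_mul]
    · rw [if_neg h1, mul_zero]
  · simp

end Gates

/-! ### The subgroup `IN` as the stabilizer of the label of `Y₁` -/

section Stabilizer

variable {n : ℕ}

/-- The label of the Weyl operator `Z₁ X₁`, which is `Y₁` up to a phase. -/
def firstLabel (n : ℕ) : SymplVec (n + 1) :=
  Pi.single (Sum.inl 0) 1 + Pi.single (Sum.inr 0) 1

theorem firstY_val (n : ℕ) : (firstY n).1 = onQubit 0 (pauliZ.1 * pauliX.1) := by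
  rw [firstY, tensorU_mulSingle]
  rfl

theorem weyl_firstLabel (n : ℕ) : weyl (firstLabel n) = firstY n := by
  refine Subtype.ext ?_
  have h := weyl_mul (Pi.single (Sum.inl 0) 1 : SymplVec (n + 1)) (Pi.single (Sum.inr 0) 1)
  rw [weyl_single_inl, weyl_single_inr, onQubit_mul] at h
  rw [firstY_val, h]
  simp [firstLabel]

theorem firstY_mul_self (n : ℕ) : (firstY n).1 * (firstY n).1 = -1 := by
  have h : pauliZ.1 * pauliX.1 * (pauliZ.1 * pauliX.1) = (-1 : ℂ) • 1 := by
    ext a b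
    fin_cases a <;> fin_cases b <;> simp [pauliX, pauliZ, Matrix.mul_apply]
  rw [firstY_val, onQubit_mul, h, onQubit_smul, onQubit_one, neg_one_smul]

theorem firstY_mem_pauliGroup (n : ℕ) : firstY n ∈ pauliGroup (n + 1) :=
  weyl_firstLabel n ▸ weyl_mem_pauliGroup _

/-- The label of `I ⊗ P`, where `P` is the Weyl operator with label `w`. -/
def tailLabel (w : SymplVec n) : SymplVec (n + 1) :=
  Sum.elim (Fin.cons 0 fun i => w (Sum.inl i)) (Fin.cons 0 fun i => w (Sum.inr i))

theorem tailLabel_add (w w' : SymplVec n) : tailLabel (w + w') = tailLabel w + tailLabel w' := by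
  funext i
  rcases i with i | i <;> refine Fin.cases ?_ (fun i => ?_) i <;> simp [tailLabel]

theorem tailLabel_zero : tailLabel (0 : SymplVec n) = 0 := by
  funext i
  rcases i with i | i <;> refine Fin.cases ?_ (fun i => ?_) i <;> simp [tailLabel]

theorem symplForm_tailLabel (w w' : SymplVec n) :
    symplForm (n + 1) (tailLabel w) (tailLabel w') = symplForm n w w' := by
  simp [symplForm_apply, tailLabel, Fin.sum_univ_succ]

theorem symplForm_firstLabel (x : SymplVec (n + 1)) :
    symplForm (n + 1) (firstLabel n) x = x (Sum.inr 0) + x (Sum.inl 0) := by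
  rw [firstLabel, map_add, LinearMap.add_apply, symplForm_single_inl, symplForm_single_inr]

theorem symplForm_firstLabel_tailLabel (w : SymplVec n) :
    symplForm (n + 1) (firstLabel n) (tailLabel w) = 0 := by
  rw [symplForm_firstLabel]
  simp [tailLabel]

/-- Splitting off the first qubit. -/
theorem eq_add_tailLabel (x : SymplVec (n + 1)) : x =
    x (Sum.inl 0) • Pi.single (Sum.inl 0) 1 + x (Sum.inr 0) • Pi.single (Sum.inr 0) 1 +
      tailLabel (Sum.elim (fun i => x (Sum.inl i.succ)) fun i => x (Sum.inr i.succ)) := by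
  funext i
  rcases i with i | i <;> refine Fin.cases ?_ (fun i => ?_) i <;>
    simp [tailLabel]

theorem tailLabel_single_inr (i : Fin n) :
    tailLabel (Pi.single (Sum.inr i) 1) = Pi.single (Sum.inr i.succ) 1 := by
  funext j
  rcases j with j | j <;> refine Fin.cases ?_ (fun j => ?_) j <;>
    simp [tailLabel, Pi.single_apply, (Fin.succ_ne_zero i).symm]

theorem idTensor_weyl (w : SymplVec n) : idTensor (weyl w).1 = (weyl (tailLabel w)).1 := by
  rw [weyl_val, idTensor_tensor, weyl_val]
  congr 1
  funext i
  refine Fin.cases ?_ (fun i => ?_) i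
  · simp [tailLabel, weylOne]
  · simp [tailLabel]

theorem cls_mem_inertiaIN {U : cliff (n + 1)} (h : U.1.1 ∈ inertiaGenerators n) :
    cls (n + 1) U ∈ inertiaIN n := Subgroup.subset_closure ⟨U, rfl, h⟩

/-- The Hadamard gate on the first qubit is `Z₁ (1 + P) / √2` with `P = Z₁ X₁`. -/
theorem onQubit_hadamard_eq (n : ℕ) : onQubit (0 : Fin (n + 1)) hadamard =
    (weyl (Pi.single (Sum.inl 0) 1)).1 * (pauliRotation (firstY n) (firstY_mul_self n)).1 := by
  rw [pauliRotation_val, weyl_single_inl, firstY_val, Matrix.mul_smul, mul_add, mul_one,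
    hadamard_eq, onQubit_smul, onQubit_mul, ← onQubit_add, mul_add, mul_one]

/-- The gate `M` is `((1 + P) / √2) X₂` with `P = Z₁ X₁ X₂`. -/
theorem exists_pauliRotation_gateM {k : Fin (n + 1)} (hk : k ≠ 0) :
    ∃ P, ∃ hP : P.1 * P.1 = -1, P ∈ pauliGroup (n + 1) ∧
      (∃ c : ℂ, P.1 = c • (weyl (firstLabel n + Pi.single (Sum.inr k) 1)).1) ∧
      gateM 0 k = (pauliRotation P hP).1 * (weyl (Pi.single (Sum.inr k) 1)).1 := by
  have hXX : onQubit k pauliX.1 * onQubit k pauliX.1 = 1 := by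
    rw [onQubit_mul, pauliX_mul_self, onQubit_one]
  have hval : (firstY n * weyl (Pi.single (Sum.inr k) 1)).1 =
    (firstY n).1 * onQubit k pauliX.1 := by
    rw [← weyl_single_inr]; rfl
  have hcomm : onQubit k pauliX.1 * (firstY n).1 = (firstY n).1 * onQubit k pauliX.1 := by
    rw [firstY_val, onQubit_comm hk]
  refine ⟨firstY n * weyl (Pi.single (Sum.inr k) 1), ?_,
    mul_mem (firstY_mem_pauliGroup n) (weyl_mem_pauliGroup _),
    ⟨signChar (∑ i, firstLabel n (Sum.inr i) *
      (Pi.single (Sum.inr k) 1 : SymplVec (n + 1)) (Sum.inl i)), ?_⟩, ?_⟩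
  · rw [hval, mul_assoc, ← mul_assoc _ (firstY n).1, hcomm, mul_assoc (firstY n).1, hXX, mul_one,
      firstY_mul_self]
  · rw [← weyl_firstLabel]
    exact weyl_mul _ _
  · rw [pauliRotation_val, hval, gateM_eq hk.symm, weyl_single_inr, Matrix.smul_mul, add_mul,
      one_mul, mul_assoc, hXX, mul_one, firstY_val]

/-- The unitaries `(1 + P) / √2` for Pauli operators `P` on the other qubits have the form `I ⊗ A`
with `A` in the Clifford group. -/
theorem exists_pauliRotation_idTensor {w : SymplVec n} (hw : w ≠ 0) :
    ∃ P, ∃ hP : P.1 * P.1 = -1, P ∈ pauliGroup (n + 1) ∧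
      (∃ c : ℂ, P.1 = c • (weyl (tailLabel w)).1) ∧
      (pauliRotation P hP).1 ∈ inertiaGenerators n := by
  have hn : NeZero n := ⟨by
    rintro rfl
    exact hw (Subsingleton.elim _ _)⟩
  obtain ⟨P, hPm, hP, c, hc⟩ := exists_pauli_mul_self_eq_neg_one w
  have hPm' := hPm
  have hPP := hP
  obtain ⟨p, hp, rfl⟩ := hPm'
  set P' : Matrix.unitaryGroup (Qubits (n + 1)) ℂ := tensorU (n + 1) (Fin.cons 1 p)
  have hval : P'.1 = idTensor (tensorU n p).1 := by
    refine Eq.trans ?_ (idTensor_tensor _).symm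
    show tensor _ = tensor _
    congr 1
    funext i
    refine Fin.cases rfl (fun i => rfl) i
  have hP'c : P'.1 = c • (weyl (tailLabel w)).1 := by
    rw [hval, hc, idTensor_smul, idTensor_weyl]
  have hP' : P'.1 * P'.1 = -1 := by
    have hone : ∀ m (d e : ℂ), d • (1 : Matrix (Qubits m) (Qubits m) ℂ) = e • 1 → d = e :=
      fun m d e h =>
        smul_left_injective ℂ (unitary_ne_zero (1 : Matrix.unitaryGroup (Qubits m) ℂ)) h
    rw [hc, Matrix.smul_mul, Matrix.mul_smul, weyl_mul_self, smul_smul, smul_smul,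
      ← neg_one_smul ℂ] at hP
    have h := hone _ _ _ hP
    rw [hP'c, Matrix.smul_mul, Matrix.mul_smul, weyl_mul_self, smul_smul, smul_smul,
      ← neg_one_smul ℂ, ← h]
    simp [tailLabel, Fin.sum_univ_succ]
  refine ⟨P', hP', Subgroup.mem_map_of_mem _ ?_, ⟨c, hP'c⟩,
    Or.inr ⟨_, pauliRotation_mem_cliff hPP hPm, ?_⟩⟩
  · rw [Subgroup.mem_pi]
    intro i _
    refine Fin.cases (one_mem _) (fun i => hp i (Set.mem_univ i)) i
  · rw [pauliRotation_val, pauliRotation_val, idTensor_smul, idTensor_add, idTensor_one, hval]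

theorem cliffAction_cls_mul_weylCliff {U : cliff (n + 1)}
    {f : SymplVec (n + 1) →ₗ[ZMod 2] SymplVec (n + 1)}
    (hU : cliffAction (cls (n + 1) U) = f) (x : SymplVec (n + 1)) :
    cliffAction (cls (n + 1) (U * weylCliff x)) = f ∧
      cliffAction (cls (n + 1) (weylCliff x * U)) = f := by
  subst hU
  constructor <;> refine LinearMap.ext fun y => ?_
  · rw [map_mul, cliffAction_mul]
    exact congrArg _ (cliffAction_weylCls x y)
  · rw [map_mul, cliffAction_mul]
    exact cliffAction_weylCls x _

theorem exists_cls_eq_onQubit_hadamard (n : ℕ) : ∃ U : cliff (n + 1),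
    U.1.1 = onQubit 0 hadamard ∧
      cliffAction (cls (n + 1) U) = symplTransvection (symplForm (n + 1)) (firstLabel n) := by
  have hR := cliffAction_pauliRotation (firstY_mul_self n) (firstY_mem_pauliGroup n) (c := 1)
    (a := firstLabel n) (by rw [weyl_firstLabel, one_smul])
  refine ⟨_, ?_, (cliffAction_cls_mul_weylCliff hR (Pi.single (Sum.inl 0) 1)).2⟩
  rw [onQubit_hadamard_eq]
  rfl

theorem exists_cls_eq_gateM {k : Fin (n + 1)} (hk : k ≠ 0) : ∃ U : cliff (n + 1),
    U.1.1 = gateM 0 k ∧ cliffAction (cls (n + 1) U) =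
      symplTransvection (symplForm (n + 1)) (firstLabel n + Pi.single (Sum.inr k) 1) := by
  obtain ⟨P, hP, hPm, ⟨c, hc⟩, h⟩ := exists_pauliRotation_gateM hk
  have hR := cliffAction_pauliRotation hP hPm hc
  refine ⟨_, ?_, (cliffAction_cls_mul_weylCliff hR (Pi.single (Sum.inr k) 1)).1⟩
  rw [h]
  rfl

theorem cls_eq_of_val_eq {U V : cliff n} (h : U.1.1 = V.1.1) : cls n U = cls n V :=
  cls_eq_of_eq_smul (c := 1) (by rw [h, one_smul])

/-- The generators of `IN` fix the label of `Y₁`: `M` and `H₁` act as transvections along vectors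
orthogonal to it, `X₁` acts trivially, and `I ⊗ A` commutes with `Y₁`. -/
theorem cliffAction_firstLabel_of_mem {g : ProjCliff (n + 1)} (hg : g ∈ inertiaIN n) :
    cliffAction g (firstLabel n) = firstLabel n := by
  induction hg using Subgroup.closure_induction with
  | one => exact cliffAction_one _
  | mul g h _ _ hg hh => rw [cliffAction_mul, hh, hg]
  | inv g _ hg => rw [← hg, cliffAction_inv_apply, hg]
  | mem g hg =>
    obtain ⟨U, rfl, ((⟨k, hk, hU⟩ | hU | hU) | ⟨A, -, hU⟩)⟩ := hg
    · have hk0 : k ≠ 0 := fun h => by simp [h] at hk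
      obtain ⟨i, rfl⟩ := Fin.exists_succ_eq.2 hk0
      obtain ⟨V, hV, hact⟩ := exists_cls_eq_gateM hk0
      rw [cls_eq_of_val_eq (hU.trans hV.symm), hact, symplTransvection_of_eq_zero]
      rw [map_add, symplForm_isAlt, zero_add, ← tailLabel_single_inr,
        symplForm_firstLabel_tailLabel]
    · obtain ⟨V, hV, hact⟩ := exists_cls_eq_onQubit_hadamard n
      rw [cls_eq_of_val_eq (hU.trans hV.symm), hact, symplTransvection_of_eq_zero]
      exact symplForm_isAlt _ _
    · rw [cls_eq_of_val_eq (V := weylCliff (Pi.single (Sum.inr 0) 1))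
        (hU.trans (weyl_single_inr 0).symm)]
      exact cliffAction_weylCls _ _
    · refine cliffAction_eq_of_conj (c := 1) ?_
      rw [weyl_firstLabel, one_smul]
      refine congrArg Subtype.val (mul_inv_eq_iff_eq_mul.2 (Subtype.ext ?_) :
        (U : Matrix.unitaryGroup (Qubits (n + 1)) ℂ) * firstY n * U⁻¹ = firstY n)
      show U.1.1 * (firstY n).1 = (firstY n).1 * U.1.1
      rw [hU, firstY_val, idTensor_mul_onQubit_zero]

/-- The vectors such that the transvection along them is realized in `IN`. -/
def inertiaTransvections (n : ℕ) : Set (SymplVec (n + 1)) :=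
  {a | ∃ g ∈ inertiaIN n, cliffAction g = symplTransvection (symplForm (n + 1)) a}

theorem symplTransvection_map {V : Type*} [AddCommGroup V] [Module (ZMod 2) V]
    {ω : LinearMap.BilinForm (ZMod 2) V} {f g : V →ₗ[ZMod 2] V} (hf : ∀ x y, ω (f x) (f y) = ω x y)
    (hfg : ∀ x, f (g x) = x) (a x : V) :
    f (symplTransvection ω a (g x)) = symplTransvection ω (f a) x := by
  rw [symplTransvection_apply, symplTransvection_apply, map_add, map_smul, hfg, ← hf, hfg]

/-- Conjugating the transvection along `a` by the transvection along `b` gives the transvection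
along `a + b` if `ω(a, b) = 1`. -/
theorem add_mem_inertiaTransvections {a b : SymplVec (n + 1)} (ha : a ∈ inertiaTransvections n)
    (hb : b ∈ inertiaTransvections n) (hab : symplForm (n + 1) a b = 1) :
    a + b ∈ inertiaTransvections n := by
  obtain ⟨g, hg, hga⟩ := ha
  obtain ⟨h, hh, hhb⟩ := hb
  refine ⟨h * g * h⁻¹, mul_mem (mul_mem hh hg) (inv_mem hh), LinearMap.ext fun x => ?_⟩
  rw [cliffAction_mul, cliffAction_mul, hga,
    symplTransvection_map (symplForm_cliffAction h) (cliffAction_apply_inv h), hhb,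
    symplTransvection_of_eq_one hab]

theorem tailLabel_mem_inertiaTransvections (w : SymplVec n) :
    tailLabel w ∈ inertiaTransvections n := by
  by_cases hw : w = 0
  · refine ⟨1, one_mem _, LinearMap.ext fun x => ?_⟩
    rw [hw, tailLabel_zero, cliffAction_one, symplTransvection_of_eq_zero (map_zero _)]
  · obtain ⟨P, hP, hPm, ⟨c, hc⟩, h⟩ := exists_pauliRotation_idTensor hw
    exact ⟨_, cls_mem_inertiaIN (U := ⟨_, pauliRotation_mem_cliff hP hPm⟩) h,
      cliffAction_pauliRotation hP hPm hc⟩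

theorem firstLabel_mem_inertiaTransvections (n : ℕ) : firstLabel n ∈ inertiaTransvections n := by
  obtain ⟨U, hU, h⟩ := exists_cls_eq_onQubit_hadamard n
  exact ⟨_, cls_mem_inertiaIN (Or.inl (Or.inr (Or.inl hU))), h⟩

/-- Conjugating `M` by the gates `I ⊗ A` gives all the transvections along `v + w`, where `v` is
the label of `Y₁` and `w ≠ 0` is a label supported on the other qubits. -/
theorem firstLabel_add_tailLabel_mem (w : SymplVec n) :
    firstLabel n + tailLabel w ∈ inertiaTransvections n := by
  by_cases hw : w = 0
  · rw [hw, tailLabel_zero, add_zero]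
    exact firstLabel_mem_inertiaTransvections n
  cases n with
  | zero => exact absurd (Subsingleton.elim _ _) hw
  | succ m =>
    have hS : ∀ b ∈ {w | firstLabel (m + 1) + tailLabel w ∈ inertiaTransvections (m + 1)}, ∀ c,
        symplForm (m + 1) b c = 1 →
        b + c ∈ {w | firstLabel (m + 1) + tailLabel w ∈ inertiaTransvections (m + 1)} := by
      intro b hb c hc
      rw [Set.mem_ofPred_eq, tailLabel_add, ← add_assoc]
      refine add_mem_inertiaTransvections hb (tailLabel_mem_inertiaTransvections c) ?_
      rw [map_add, LinearMap.add_apply, symplForm_firstLabel_tailLabel, zero_add,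
        symplForm_tailLabel, hc]
    have h0 : (Pi.single (Sum.inr 0) 1 : SymplVec (m + 1)) ≠ 0 := by
      rw [Ne, Pi.single_eq_zero_iff]
      exact one_ne_zero
    refine mem_of_forall_add_mem (symplForm_isAlt _) symplForm_nondegenerate hS h0 hw ?_
    obtain ⟨U, hU, h⟩ := exists_cls_eq_gateM (Fin.succ_ne_zero (0 : Fin (m + 1)))
    rw [Set.mem_ofPred_eq, tailLabel_single_inr]
    exact ⟨_, cls_mem_inertiaIN (Or.inl (Or.inl ⟨Fin.succ 0, by simp, hU⟩)), h⟩

theorem mem_inertiaTransvections {a : SymplVec (n + 1)}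
    (ha : symplForm (n + 1) (firstLabel n) a = 0) : a ∈ inertiaTransvections n := by
  have h2 : a (Sum.inr 0) = a (Sum.inl 0) := by
    rw [symplForm_firstLabel] at ha
    rw [← sub_eq_zero, CharTwo.sub_eq_add, ha]
  have h := eq_add_tailLabel a
  rw [h2, ← smul_add] at h
  rcases ZMod.eq_zero_or_eq_one_of_two (a (Sum.inl 0)) with h0 | h0
  · rw [h0, zero_smul, zero_add] at h
    rw [h]
    exact tailLabel_mem_inertiaTransvections _
  · rw [h0, one_smul] at h
    rw [h]
    exact firstLabel_add_tailLabel_mem _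

theorem weylCls_mem_inertiaIN (x : SymplVec (n + 1)) : weylCls x ∈ inertiaIN n := by
  have hX : weylCls (Pi.single (Sum.inr 0) 1) ∈ inertiaIN n :=
    cls_mem_inertiaIN (Or.inl (Or.inr (Or.inr (weyl_single_inr 0))))
  -- the Hadamard gate exchanges `X₁` and `Z₁`
  have hZ : weylCls (Pi.single (Sum.inl 0) 1) ∈ inertiaIN n := by
    obtain ⟨g, hg, h⟩ := firstLabel_mem_inertiaTransvections n
    have h1 : cliffAction g (Pi.single (Sum.inr 0) 1) = Pi.single (Sum.inl 0) 1 := by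
      rw [h, symplTransvection_of_eq_one, firstLabel, add_left_comm, ZMod.add_self_two, add_zero]
      rw [symplForm_single_inr]
      simp [firstLabel]
    rw [← h1, weylCls_cliffAction]
    exact mul_mem (mul_mem hg hX) (inv_mem hg)
  have hsmul : ∀ (c : ZMod 2) (y : SymplVec (n + 1)), weylCls y ∈ inertiaIN n →
      weylCls (c • y) ∈ inertiaIN n := fun c y hy => by
    rcases ZMod.eq_zero_or_eq_one_of_two c with rfl | rfl
    · rw [zero_smul, weylCls_zero]
      exact one_mem _
    · rwa [one_smul]
  rw [eq_add_tailLabel x, weylCls_add, weylCls_add]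
  refine mul_mem (mul_mem (hsmul _ _ hZ) (hsmul _ _ hX)) (cls_mem_inertiaIN (Or.inr ⟨weyl _,
    pauliGroup_le_cliff n (weyl_mem_pauliGroup _), (idTensor_weyl _).symm⟩))

theorem projPauli_le_inertiaIN (n : ℕ) : projPauli (n + 1) ≤ inertiaIN n := fun g hg => by
  obtain ⟨x, rfl⟩ := mem_projPauli_iff.1 hg
  exact weylCls_mem_inertiaIN x

/-- `IN` is the stabilizer of the label of `Y₁`: it acts on labels through all the isometries fixing
this label, and it contains the kernel of the action. -/
theorem mem_inertiaIN_iff {g : ProjCliff (n + 1)} :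
    g ∈ inertiaIN n ↔ cliffAction g (firstLabel n) = firstLabel n := by
  refine ⟨cliffAction_firstLabel_of_mem, fun hg => ?_⟩
  obtain ⟨h, hh, hact⟩ := exists_mem_cliffAction_eq (fun a => mem_inertiaTransvections)
    (symplForm_cliffAction g) hg
  have : h⁻¹ * g ∈ projPauli (n + 1) := mem_projPauli_iff_cliffAction.2 fun x => by
    rw [cliffAction_mul, ← hact, cliffAction_inv_apply]
  simpa using mul_mem hh (projPauli_le_inertiaIN n this)

end Stabilizer

/-! ### The character `σ₁` and its inertia group -/

theorem charRep_apply {G : Type*} [Group G] (χ : G →* ℂˣ) (g : G) (z : ℂ) :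
    charRep χ g z = ((χ g : ℂˣ) : ℂ) • z := rfl

theorem mem_inertia_charRep_iff {G : Type*} [Group G] {N : Subgroup G} [N.Normal] (χ : N →* ℂˣ)
    {g : G} : g ∈ inertia (charRep χ) ↔ ∀ m : N, χ (MulAut.conjNormal g⁻¹ m) = χ m := by
  constructor
  · rintro ⟨e⟩ m
    have h := Representation.Equiv.apply_apply e m 1
    rw [conjRep_apply, charRep_apply, charRep_apply, map_smul] at h
    refine Units.ext (smul_left_injective ℂ ?_ h)
    rw [Ne, LinearEquiv.map_eq_zero_iff]
    exact one_ne_zero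
  · intro h
    have h' : conjRep g (charRep χ) = charRep χ := MonoidHom.ext fun m => LinearMap.ext fun z => by
      rw [conjRep_apply, charRep_apply, charRep_apply, h]
    show Nonempty ((conjRep g (charRep χ)).Equiv (charRep χ))
    rw [h']
    exact ⟨Representation.Equiv.refl _⟩

section SigmaOne

variable {n : ℕ}

theorem sigmaOne_weylCls (x : SymplVec (n + 1)) :
    (sigmaOne n ⟨weylCls x, weylCls_mem x⟩ : ℂ) =
      signChar (symplForm (n + 1) x (firstLabel n)) := by
  have h := weyl_comm x (firstLabel n)
  rw [weyl_firstLabel] at h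
  rcases ZMod.eq_zero_or_eq_one_of_two (symplForm (n + 1) x (firstLabel n)) with h0 | h0
  · rw [h0, AddChar.map_zero_eq_one, one_smul] at h
    rw [h0, AddChar.map_zero_eq_one]
    exact congrArg Units.val
      (sigmaOne_of_comm (P := ⟨weyl x, weyl_mem_pauliGroup x⟩) (Subtype.ext h))
  · rw [h0, signChar_one, neg_one_smul] at h
    rw [h0, signChar_one]
    exact congrArg Units.val
      (sigmaOne_of_anti (P := ⟨weyl x, weyl_mem_pauliGroup x⟩) (Subtype.ext h))

/-- The character `σ₁` is the pairing with the label of `Y₁`, so that `g` fixes the character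
exactly if it fixes this label. -/
theorem sigmaOne_conj_iff {g : ProjCliff (n + 1)} :
    (∀ m : projPauli (n + 1), sigmaOne n (MulAut.conjNormal g⁻¹ m) = sigmaOne n m) ↔
      cliffAction g (firstLabel n) = firstLabel n := by
  have hconj : ∀ x, MulAut.conjNormal g⁻¹ (⟨weylCls x, weylCls_mem x⟩ : projPauli (n + 1)) =
      ⟨weylCls (cliffAction g⁻¹ x), weylCls_mem _⟩ := fun x =>
    Subtype.ext (weylCls_cliffAction g⁻¹ x).symm
  have hadj : ∀ x, symplForm (n + 1) (cliffAction g⁻¹ x) (firstLabel n) =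
      symplForm (n + 1) x (cliffAction g (firstLabel n)) := fun x => by
    rw [← symplForm_cliffAction g, cliffAction_apply_inv]
  constructor
  · intro h
    rw [← sub_eq_zero]
    refine symplForm_nondegenerate _ fun x => ?_
    rw [map_sub, sub_eq_zero]
    refine signChar_injective ?_
    rw [← hadj, ← sigmaOne_weylCls, ← sigmaOne_weylCls, ← hconj, h]
  · rintro h ⟨m, hm⟩
    obtain ⟨x, rfl⟩ := mem_projPauli_iff.1 hm
    rw [hconj]
    refine Units.ext ?_
    rw [sigmaOne_weylCls, sigmaOne_weylCls, hadj, h]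

theorem mem_inertiaIN_iff_sigmaOne {g : ProjCliff (n + 1)} :
    g ∈ inertiaIN n ↔
      ∀ m : projPauli (n + 1), sigmaOne n (MulAut.conjNormal g⁻¹ m) = sigmaOne n m := by
  rw [mem_inertiaIN_iff, sigmaOne_conj_iff]

theorem inertiaIN_eq_inertia (n : ℕ) : inertiaIN n = inertia (charRep (sigmaOne n)) := by
  ext g
  rw [mem_inertia_charRep_iff, mem_inertiaIN_iff_sigmaOne]

theorem commOrAnti_of_mem_inertiaIN {U : cliff (n + 1)} (hU : cls (n + 1) U ∈ inertiaIN n) :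
    CommOrAnti (U : Matrix.unitaryGroup (Qubits (n + 1)) ℂ) (firstY n) := by
  obtain ⟨c, hc⟩ := conj_weyl U (firstLabel n)
  rw [mem_inertiaIN_iff.1 hU, weyl_firstLabel] at hc
  have h1 : U.1.1 * (firstY n).1 = c • ((firstY n).1 * U.1.1) := by
    rw [← Matrix.smul_mul, ← hc]
    exact congrArg Subtype.val (inv_mul_cancel_right (U.1 * firstY n) U.1).symm
  -- squaring `U Y₁ U⁻¹ = c Y₁` gives `c² = 1`
  have h2 : U.1.1 * ((firstY n).1 * (firstY n).1) =
      (c * c) • ((firstY n).1 * (firstY n).1 * U.1.1) := by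
    rw [← mul_assoc, h1, Matrix.smul_mul, mul_assoc, h1, Matrix.mul_smul, smul_smul, mul_assoc]
  have h3 : c * c = 1 := by
    refine smul_left_injective ℂ (unitary_ne_zero U.1) ?_
    rw [firstY_mul_self] at h2
    simpa using h2.symm
  rcases mul_self_eq_one_iff.1 h3 with rfl | rfl
  · exact Or.inl (Subtype.ext (by rw [one_smul] at h1; exact h1))
  · exact Or.inr (Subtype.ext (by rw [neg_one_smul] at h1; exact h1))

open Classical in
/-- The sign `± 1` in `U Y₁ U⁻¹ = ± Y₁`, as a character of `IN`. It does not depend on the choice of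
the unitary `U` in its class, so it is `1` exactly if some `U` commutes with `Y₁`. -/
noncomputable def conjSign (n : ℕ) : inertiaIN n →* ℂˣ where
  toFun g := if ∃ U : cliff (n + 1), cls (n + 1) U = g ∧
      (U : Matrix.unitaryGroup (Qubits (n + 1)) ℂ) * firstY n = firstY n * U then 1 else -1
  map_one' := if_pos ⟨1, map_one _, by simp⟩
  map_mul' := by
    have key : ∀ (g : inertiaIN n) (U : cliff (n + 1)), cls (n + 1) U = g →
        ((∃ V : cliff (n + 1), cls (n + 1) V = g ∧
          (V : Matrix.unitaryGroup (Qubits (n + 1)) ℂ) * firstY n = firstY n * V) ↔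
          (U : Matrix.unitaryGroup (Qubits (n + 1)) ℂ) * firstY n = firstY n * U) :=
      fun g U hU => ⟨fun ⟨V, hV, h⟩ => (comm_firstY_congr (hV.trans hU.symm)).1 h,
        fun h => ⟨U, hU, h⟩⟩
    intro g h
    obtain ⟨U, hU⟩ := cls_surjective _ (g : ProjCliff (n + 1))
    obtain ⟨V, hV⟩ := cls_surjective _ (h : ProjCliff (n + 1))
    have hUV : cls (n + 1) (U * V) = (g * h : inertiaIN n) := by
      rw [map_mul, hU, hV]; rfl
    have e := comm_mul_iff unitary_ne_neg
      (commOrAnti_of_mem_inertiaIN (U := U) (by rw [hU]; exact g.2))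
      (commOrAnti_of_mem_inertiaIN (U := V) (by rw [hV]; exact h.2))
    simp only [key _ _ hU, key _ _ hV, key _ _ hUV]
    rw [Subgroup.coe_mul]
    by_cases h1 : (U : Matrix.unitaryGroup (Qubits (n + 1)) ℂ) * firstY n = firstY n * U <;>
      by_cases h2 : (V : Matrix.unitaryGroup (Qubits (n + 1)) ℂ) * firstY n = firstY n * V <;>
      simp only [e, h1, h2, if_true, if_false, mul_one, one_mul, iff_true, iff_false, not_true,
        neg_mul_neg]

theorem isExtension_conjSign (n : ℕ) :
    IsExtension (charRep (sigmaOne n)) (charRep (conjSign n)) :=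
  ⟨projPauli_le_inertiaIN n, rfl⟩

end SigmaOne

/-! ### Weights of the projective Pauli group in a representation -/

section Weights

open Representation

variable {n : ℕ} {V : Type*} [AddCommGroup V] [Module ℂ V]

theorem sum_signChar_symplForm (x : SymplVec n) [DecidableEq (SymplVec n)] :
    ∑ a, signChar (symplForm n x a) = if x = 0 then (Fintype.card (SymplVec n) : ℂ) else 0 := by
  split_ifs with hx
  · simp [hx]
  · refine AddChar.sum_eq_zero_of_ne_one
      (ψ := signChar.compAddMonoidHom (symplForm n x).toAddMonoidHom) fun h => hx ?_
    refine symplForm_nondegenerate x fun a => ?_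
    rw [(symplForm_isAlt n).eq_swap]
    exact signChar_injective ((DFunLike.congr_fun h a).trans signChar.map_zero_eq_one.symm)

/-- If the projective Pauli group acts nontrivially in a representation of the projective Clifford
group, then the character `σ₁` occurs. Indeed, some nontrivial character occurs, and the nontrivial
characters are conjugate. -/
theorem weightSpace_sigmaOne_ne_bot {ρ : Representation ℂ (ProjCliff (n + 1)) V}
    (h : ¬ ∀ g ∈ projPauli (n + 1), ∀ v, ρ g v = v) : ρ.weightSpace (sigmaOne n) ≠ ⊥ := by
  classical
  intro hbot
  -- the component of `v` on which the Pauli operators act through `x ↦ (-1) ^ ω(x, a)`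
  let p : SymplVec (n + 1) → V → V := fun a v =>
    ∑ x, signChar (symplForm (n + 1) x a) • ρ (weylCls x) v
  have hp : ∀ a v y, ρ (weylCls y) (p a v) = signChar (symplForm (n + 1) y a) • p a v := by
    intro a v y
    simp only [p, map_sum, map_smul, Finset.smul_sum, smul_smul]
    rw [← Equiv.sum_comp (Equiv.addLeft y)
      fun x => (signChar (symplForm (n + 1) y a) * signChar (symplForm (n + 1) x a)) • _]
    refine Finset.sum_congr rfl fun x _ => ?_
    rw [Equiv.coe_addLeft, map_add, LinearMap.add_apply, AddChar.map_add_eq_mul, ← mul_assoc,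
      signChar_mul_self, one_mul, weylCls_add, map_mul, Module.End.mul_apply]
  have hsum : ∀ v, ∑ a, p a v = (Fintype.card (SymplVec (n + 1)) : ℂ) • v := by
    intro v
    simp only [p]
    rw [Finset.sum_comm]
    simp only [← Finset.sum_smul, sum_signChar_symplForm]
    rw [Finset.sum_eq_single 0]
    · rw [if_pos rfl, weylCls_zero, map_one, Module.End.one_apply]
    · intro x _ hx
      rw [if_neg hx, zero_smul]
    · simp
  have hzero : ∀ a, a ≠ 0 → ∀ v, p a v = 0 := by
    intro a ha v
    have hv : firstLabel n ≠ 0 := fun h => by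
      have := congrFun h (Sum.inl 0)
      simp [firstLabel] at this
    obtain ⟨g, hg⟩ := exists_cliffAction_apply_eq ha hv
    have hmem : ρ g (p a v) ∈ ρ.weightSpace (sigmaOne n) := by
      rintro ⟨m, hm⟩
      obtain ⟨x, rfl⟩ := mem_projPauli_iff.1 hm
      have hx : weylCls x * g = g * weylCls (cliffAction g⁻¹ x) := by
        rw [weylCls_cliffAction]
        group
      show ρ (weylCls x) (ρ g (p a v)) = _
      rw [← Module.End.mul_apply, ← map_mul, hx, map_mul, Module.End.mul_apply, hp, map_smul,
        sigmaOne_weylCls, ← hg, ← symplForm_cliffAction g, cliffAction_apply_inv]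
    rw [hbot, Submodule.mem_bot] at hmem
    have := congrArg (ρ g⁻¹) hmem
    rwa [← Module.End.mul_apply, ← map_mul, inv_mul_cancel, map_one, map_zero] at this
  refine h fun g hg v => ?_
  obtain ⟨x, rfl⟩ := mem_projPauli_iff.1 hg
  have h0 : p 0 v = (Fintype.card (SymplVec (n + 1)) : ℂ) • v := by
    rw [← hsum, Finset.sum_eq_single 0]
    · exact fun a _ ha => hzero a ha v
    · simp
  have h1 := hp 0 v x
  rw [h0, map_zero, AddChar.map_zero_eq_one, one_smul, map_smul] at h1
  exact smul_right_injective V (Nat.cast_ne_zero.2 Fintype.card_ne_zero) h1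

end Weights

/-! ### The two kinds of representations -/

section Inflation

variable {G : Type*} [Group G] {N : Subgroup G} [N.Normal] {V W : Type*} [AddCommGroup V]
  [Module ℂ V] [AddCommGroup W] [Module ℂ W]

theorem inflate_apply (ψ : Representation ℂ (G ⧸ N) V) (g : G) (v : V) :
    inflate N ψ g v = ψ (QuotientGroup.mk g) v := rfl

theorem inflate_apply_of_mem (ψ : Representation ℂ (G ⧸ N) V) {g : G} (hg : g ∈ N) (v : V) :
    inflate N ψ g v = v := by
  rw [inflate_apply, (QuotientGroup.eq_one_iff g).2 hg, map_one, Module.End.one_apply]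

/-- The value of a one-dimensional representation on `ℂ`, as a homomorphism to `ℂ`. -/
noncomputable def scalarOf (σ : Representation ℂ G ℂ) : G →* ℂ where
  toFun g := σ g 1
  map_one' := by simp
  map_mul' g h := by
    rw [map_mul, Module.End.mul_apply, ← mul_one (σ h 1), ← smul_eq_mul (σ h 1) 1, map_smul,
      smul_eq_mul, smul_eq_mul, mul_one, mul_comm]

theorem apply_eq_scalarOf_mul (σ : Representation ℂ G ℂ) (g : G) (z : ℂ) :
    σ g z = scalarOf σ g * z := by
  conv_lhs => rw [← mul_one z, ← smul_eq_mul, map_smul, smul_eq_mul, mul_comm]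
  rfl

theorem scalarOf_inv_mul (σ : Representation ℂ G ℂ) (g : G) :
    scalarOf σ g⁻¹ * scalarOf σ g = 1 := by
  rw [← map_mul, inv_mul_cancel, map_one]

theorem scalarOf_ne_zero (σ : Representation ℂ G ℂ) (g : G) : scalarOf σ g ≠ 0 := fun h => by
  have := scalarOf_inv_mul σ g
  rw [h, mul_zero] at this
  exact zero_ne_one this

theorem lid_tprod (σ : Representation ℂ G ℂ) (τ : Representation ℂ G V) (g : G)
    (t : TensorProduct ℂ ℂ V) : TensorProduct.lid ℂ V (σ.tprod τ g t) =
      scalarOf σ g • τ g (TensorProduct.lid ℂ V t) := by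
  induction t using TensorProduct.induction_on with
  | zero => simp
  | tmul z v =>
    rw [Representation.tprod_apply, TensorProduct.map_tmul, TensorProduct.lid_tmul,
      TensorProduct.lid_tmul, map_smul, apply_eq_scalarOf_mul, smul_smul]
  | add x y hx hy => simp only [map_add, hx, hy, smul_add]

theorem tprod_lid_symm (σ : Representation ℂ G ℂ) (τ : Representation ℂ G V) (g : G) (v : V) :
    σ.tprod τ g ((TensorProduct.lid ℂ V).symm v) =
      scalarOf σ g • (TensorProduct.lid ℂ V).symm (τ g v) := by
  apply (TensorProduct.lid ℂ V).injective
  rw [lid_tprod, map_smul, LinearEquiv.apply_symm_apply, LinearEquiv.apply_symm_apply]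

theorem Representation.IsIrreducible.tprod_inflate (σ : Representation ℂ G ℂ)
    {ψ : Representation ℂ (G ⧸ N) V} (hψ : ψ.IsIrreducible) :
    (σ.tprod (inflate N ψ)).IsIrreducible := by
  refine hψ.of_linearEquiv (_root_.TensorProduct.lid ℂ V).symm fun p hp g v hv => ?_
  obtain ⟨g, rfl⟩ := QuotientGroup.mk_surjective g
  have h := hp g _ hv
  rw [tprod_lid_symm] at h
  exact (p.smul_mem_iff (scalarOf_ne_zero σ g)).1 h

theorem nonempty_equiv_of_tprod_inflate (σ : Representation ℂ G ℂ)
    {ψ : Representation ℂ (G ⧸ N) V} {ψ' : Representation ℂ (G ⧸ N) W}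
    (h : Nonempty ((σ.tprod (inflate N ψ)).Equiv (σ.tprod (inflate N ψ')))) :
    Nonempty (ψ.Equiv ψ') := by
  obtain ⟨e⟩ := h
  refine Representation.nonempty_equiv_of_linearEquiv
    ((TensorProduct.lid ℂ V).symm.trans (e.toLinearEquiv.trans (TensorProduct.lid ℂ W)))
    fun g v => ?_
  obtain ⟨g, rfl⟩ := QuotientGroup.mk_surjective g
  have h := Representation.Equiv.apply_apply e g ((TensorProduct.lid ℂ V).symm v)
  rw [tprod_lid_symm, map_smul] at h
  have h' := congrArg (TensorProduct.lid ℂ W) h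
  rw [map_smul, lid_tprod] at h'
  exact smul_right_injective W (scalarOf_ne_zero σ g) h'

end Inflation

section Extension

open Representation

variable {G : Type*} [Group G] {N : Subgroup G} [N.Normal] {χ : N →* ℂˣ} {I : Subgroup G}
  (hN : N ≤ I) {σ' : Representation ℂ I ℂ}

omit [N.Normal] in
theorem scalarOf_extension (hσ : IsExtension (charRep χ) σ') (m : N) :
    scalarOf σ' (Subgroup.inclusion hN m) = χ m := by
  obtain ⟨h, hσ⟩ := hσ
  have := LinearMap.congr_fun (DFunLike.congr_fun hσ m) 1
  rw [charRep_apply, smul_eq_mul, mul_one] at this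
  exact this

theorem tprod_inflate_inclusion (hσ : IsExtension (charRep χ) σ') {W : Type*} [AddCommGroup W]
    [Module ℂ W] (ψ : Representation ℂ (I ⧸ N.subgroupOf I) W) (m : N)
    (t : TensorProduct ℂ ℂ W) :
    σ'.tprod (inflate (N.subgroupOf I) ψ) (Subgroup.inclusion hN m) t = (χ m : ℂ) • t := by
  apply (TensorProduct.lid ℂ W).injective
  rw [lid_tprod, scalarOf_extension hN hσ, inflate_apply_of_mem, map_smul]
  exact Subgroup.mem_subgroupOf.2 m.2

/-- The subgroup `N` acts nontrivially in a nonzero representation induced from one lying over a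
nontrivial character. This separates the induced representations from the inflated ones. -/
theorem exists_ind_tprod_inflate_apply_ne (hσ : IsExtension (charRep χ) σ') {m : N}
    (hm : χ m ≠ 1) {W : Type*} [AddCommGroup W] [Module ℂ W] [Nontrivial W]
    (ψ : Representation ℂ (I ⧸ N.subgroupOf I) W) :
    ∃ v, ind I.subtype (σ'.tprod (inflate (N.subgroupOf I) ψ)) m v ≠ v := by
  have hN : N ≤ I := hσ.choose
  obtain ⟨w, hw⟩ := exists_ne (0 : W)
  set t := (TensorProduct.lid ℂ W).symm w with ht
  have h := indIncl_mem_weightSpace hN (tprod_inflate_inclusion hN hσ ψ) t m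
  refine ⟨indIncl (σ'.tprod (inflate (N.subgroupOf I) ψ)) t, fun h' => hw ?_⟩
  rw [h', ← sub_eq_zero] at h
  nth_rewrite 1 [← one_smul ℂ (indIncl _ t)] at h
  rw [← sub_smul, smul_eq_zero, sub_eq_zero] at h
  have h0 := h.resolve_left fun h => hm (Units.ext h.symm)
  have h1 := indIncl_injective _ (h0.trans (map_zero _).symm)
  rwa [ht, LinearEquiv.map_eq_zero_iff] at h1

/-- Every irreducible representation in which `χ` occurs is induced from its `χ`-weight space,
and the weight space is the product of `σ'` with an irreducible representation of `I ⧸ N`. -/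
theorem exists_equiv_ind_tprod_inflate [Finite G]
    (hI : ∀ g, g ∈ I ↔ ∀ m : N, χ (MulAut.conjNormal g⁻¹ m) = χ m)
    (hσ : IsExtension (charRep χ) σ') {V : Type u} [AddCommGroup V] [Module ℂ V]
    {ρ : Representation ℂ G V} (hρ : ρ.IsIrreducible) (hbot : ρ.weightSpace χ ≠ ⊥) :
    ∃ (W : Type u) (_ : AddCommGroup W) (_ : Module ℂ W)
      (ψ : Representation ℂ (I ⧸ N.subgroupOf I) W), ψ.IsIrreducible ∧
        Nonempty (ρ.Equiv (ind I.subtype (σ'.tprod (inflate (N.subgroupOf I) ψ)))) := by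
  have hN : N ≤ I := hσ.choose
  set W := ρ.weightSpace χ
  have hnt : Nontrivial W := (Submodule.nontrivial_iff_ne_bot).2 hbot
  have hmem : ∀ g ∈ I, ∀ v ∈ W, ρ g v ∈ W := fun g hg v hv => apply_mem_weightSpace hI hg hv
  -- the action of `I` on the weight space, divided by `σ'`
  let ψ₀ : Representation ℂ I W :=
    { toFun := fun g => scalarOf σ' g⁻¹ • (ρ g).restrict (hmem g g.2)
      map_one' := by ext v; simp
      map_mul' := fun g h => by
        ext v
        simp [smul_smul, mul_comm] }
  have hψ₀ : ∀ g v, ((ψ₀ g v : W) : V) = scalarOf σ' g⁻¹ • ρ g v := fun g v => rfl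
  have hker : N.subgroupOf I ≤ ψ₀.ker := fun g hg => by
    rw [MonoidHom.mem_ker]
    ext v
    have h1 := scalarOf_extension hN hσ ⟨g, hg⟩
    have h2 : ρ g v = (χ ⟨g, hg⟩ : ℂ) • (v : V) := v.2 ⟨g, hg⟩
    rw [hψ₀, h2, ← h1, smul_smul]
    show (scalarOf σ' g⁻¹ * scalarOf σ' g) • (v : V) = v
    rw [scalarOf_inv_mul, one_smul]
  let ψ : Representation ℂ (I ⧸ N.subgroupOf I) W := QuotientGroup.lift _ ψ₀ hker
  have hψ : ∀ (g : I) v, ψ (QuotientGroup.mk g) v = ψ₀ g v := fun g v => rfl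
  refine ⟨W, inferInstance, inferInstance, ψ, ?_, ?_⟩
  · rw [isIrreducible_iff_forall_submodule]
    refine ⟨hnt, fun p hp => ?_⟩
    have hinj : Function.Injective (Submodule.map W.subtype) :=
      Submodule.map_injective_of_injective W.injective_subtype
    refine (hρ.eq_bot_or_eq_weightSpace hI (p := p.map W.subtype) (Submodule.map_subtype_le _ _)
      ?_).imp (fun h => hinj ?_) (fun h => hinj ?_)
    · rintro g hg _ ⟨v, hv, rfl⟩
      refine (Submodule.smul_mem_iff _ (scalarOf_ne_zero σ' (⟨g, hg⟩ : I)⁻¹)).1 ?_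
      exact ⟨_, hp (QuotientGroup.mk ⟨g, hg⟩) v hv, rfl⟩
    · rw [h, Submodule.map_bot]
    · rw [h, Submodule.map_subtype_top]
  · refine hρ.nonempty_equiv_ind hN hI (tprod_inflate_inclusion hN hσ ψ)
      (f := W.subtype ∘ₗ (_root_.TensorProduct.lid ℂ W).toLinearMap) ?_ ?_
    · intro i t
      show ((_root_.TensorProduct.lid ℂ W _ : W) : V) = ρ i (_root_.TensorProduct.lid ℂ W t : W)
      rw [lid_tprod, inflate_apply, hψ, Submodule.coe_smul, hψ₀, smul_smul, mul_comm,
        scalarOf_inv_mul, one_smul]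
    · exact W.injective_subtype.comp (_root_.TensorProduct.lid ℂ W).injective

end Extension

section InducedKind

open Representation

variable {n : ℕ} {W : Type*} [AddCommGroup W] [Module ℂ W]
  {σ' : Representation ℂ (inertiaIN n) ℂ}

theorem isIrreducible_inducedKind (hσ : IsExtension (charRep (sigmaOne n)) σ')
    {ψ : Representation ℂ (InertiaQuot n) W} (hψ : ψ.IsIrreducible) :
    (inducedKind σ' ψ).IsIrreducible :=
  (hψ.tprod_inflate σ').ind (projPauli_le_inertiaIN n) (fun _ => mem_inertiaIN_iff_sigmaOne)
    (tprod_inflate_inclusion _ hσ ψ)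

theorem nonempty_equiv_of_inducedKind {W' : Type*} [AddCommGroup W'] [Module ℂ W']
    (hσ : IsExtension (charRep (sigmaOne n)) σ')
    {ψ : Representation ℂ (InertiaQuot n) W} {ψ' : Representation ℂ (InertiaQuot n) W'}
    (h : Nonempty ((inducedKind σ' ψ).Equiv (inducedKind σ' ψ'))) : Nonempty (ψ.Equiv ψ') := by
  obtain ⟨e⟩ := h
  exact nonempty_equiv_of_tprod_inflate σ' (nonempty_equiv_of_ind (projPauli_le_inertiaIN n)
    (fun _ => mem_inertiaIN_iff_sigmaOne) (tprod_inflate_inclusion _ hσ ψ)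
    (tprod_inflate_inclusion _ hσ ψ') e)

theorem exists_inducedKind_apply_ne [Nontrivial W] (hσ : IsExtension (charRep (sigmaOne n)) σ')
    (ψ : Representation ℂ (InertiaQuot n) W) :
    ∃ g ∈ projPauli (n + 1), ∃ v, inducedKind σ' ψ g v ≠ v := by
  have hm : sigmaOne n (pauliCls (pauliAt 0 pX)) ≠ 1 := by
    rw [sigmaOne_X, if_pos rfl]
    exact fun h => by
      have := congrArg Units.val h
      norm_num at this
  exact ⟨_, (pauliCls (pauliAt 0 pX)).2,
    exists_ind_tprod_inflate_apply_ne hσ hm ψ⟩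

theorem exists_equiv_inducedKind {V : Type u} [AddCommGroup V] [Module ℂ V]
    {ρ : Representation ℂ (ProjCliff (n + 1)) V} (hρ : ρ.IsIrreducible)
    (hσ : IsExtension (charRep (sigmaOne n)) σ')
    (h : ¬ ∀ g ∈ projPauli (n + 1), ∀ v, ρ g v = v) :
    ∃ (W : Type u) (_ : AddCommGroup W) (_ : Module ℂ W)
      (ψ : Representation ℂ (InertiaQuot n) W),
      ψ.IsIrreducible ∧ Nonempty (ρ.Equiv (inducedKind σ' ψ)) :=
  exists_equiv_ind_tprod_inflate (fun _ => mem_inertiaIN_iff_sigmaOne) hσ hρ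
    (weightSpace_sigmaOne_ne_bot h)

end InducedKind

section InflatedKind

open Representation

variable {n : ℕ} {W W' : Type u} [AddCommGroup W] [Module ℂ W] [AddCommGroup W'] [Module ℂ W']
  (e : (ProjCliff n ⧸ projPauli n) ≃* Sp n)

theorem inflatedKind_apply (ψ : Representation ℂ (Sp n) W) (g : ProjCliff n) :
    inflatedKind e ψ g = ψ (e (QuotientGroup.mk g)) := rfl

theorem inflatedKind_apply_of_mem (ψ : Representation ℂ (Sp n) W) {g : ProjCliff n}
    (hg : g ∈ projPauli n) (w : W) : inflatedKind e ψ g w = w :=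
  inflate_apply_of_mem _ hg w

theorem exists_eq_apply_mk (s : Sp n) : ∃ g : ProjCliff n, e (QuotientGroup.mk g) = s := by
  obtain ⟨q, rfl⟩ := e.surjective s
  obtain ⟨g, rfl⟩ := QuotientGroup.mk_surjective q
  exact ⟨g, rfl⟩

theorem isIrreducible_inflatedKind {ψ : Representation ℂ (Sp n) W} (hψ : ψ.IsIrreducible) :
    (inflatedKind e ψ).IsIrreducible := by
  refine hψ.of_linearEquiv (LinearEquiv.refl ℂ W) fun p hp s w hw => ?_
  obtain ⟨g, rfl⟩ := exists_eq_apply_mk e s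
  exact hp g w hw

theorem nonempty_equiv_of_inflatedKind {ψ : Representation ℂ (Sp n) W}
    {ψ' : Representation ℂ (Sp n) W'}
    (h : Nonempty ((inflatedKind e ψ).Equiv (inflatedKind e ψ'))) : Nonempty (ψ.Equiv ψ') := by
  obtain ⟨f⟩ := h
  refine nonempty_equiv_of_linearEquiv f.toLinearEquiv fun s w => ?_
  obtain ⟨g, rfl⟩ := exists_eq_apply_mk e s
  exact Equiv.apply_apply f g w

theorem exists_equiv_inflatedKind {ρ : Representation ℂ (ProjCliff n) W} (hρ : ρ.IsIrreducible)
    (h : ∀ g ∈ projPauli n, ∀ v, ρ g v = v) :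
    ∃ ψ : Representation ℂ (Sp n) W, ψ.IsIrreducible ∧ Nonempty (ρ.Equiv (inflatedKind e ψ)) := by
  let ψ : Representation ℂ (Sp n) W :=
    (QuotientGroup.lift (projPauli n) ρ fun g hg => LinearMap.ext (h g hg)).comp
      e.symm.toMonoidHom
  have hψ : ∀ g, ψ (e (QuotientGroup.mk g)) = ρ g := fun g => by
    refine (congrArg _ (e.symm_apply_apply (QuotientGroup.mk g))).trans ?_
    rfl
  refine ⟨ψ, hρ.of_linearEquiv (LinearEquiv.refl ℂ W) fun p hp g w hw => ?_,
    nonempty_equiv_of_linearEquiv (LinearEquiv.refl ℂ W) fun g w => ?_⟩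
  · rw [← hψ]
    exact hp _ w hw
  · rw [inflatedKind_apply, hψ]
    rfl

end InflatedKind

theorem mainTheorem5 (n : ℕ) :
    inertiaIN n = inertia (charRep (sigmaOne n)) ∧
    (∃ σ' : Representation ℂ (inertiaIN n) ℂ, IsExtension (charRep (sigmaOne n)) σ') ∧
    ∃ e : (ProjCliff (n + 1) ⧸ projPauli (n + 1)) ≃* Sp (n + 1),
      (∀ (U : cliff (n + 1)) (x : Fin (n + 1) ⊕ Fin (n + 1) → ZMod 2), ∃ c : ℂ,
        (U * weyl x * U⁻¹ : Matrix.unitaryGroup (Qubits (n + 1)) ℂ).1 =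
          c • (weyl ((e (QuotientGroup.mk (cls (n + 1) U))).1 *ᵥ x)).1) ∧
      ∀ σ' : Representation ℂ (inertiaIN n) ℂ, IsExtension (charRep (sigmaOne n)) σ' →
        (∀ (W : Type u) [AddCommGroup W] [Module ℂ W] (ψ : Representation ℂ (InertiaQuot n) W),
          ψ.IsIrreducible → (inducedKind σ' ψ).IsIrreducible) ∧
        (∀ (W : Type u) [AddCommGroup W] [Module ℂ W] (ψ : Representation ℂ (Sp (n + 1)) W),
          ψ.IsIrreducible → (inflatedKind e ψ).IsIrreducible) ∧
        (∀ (V : Type u) [AddCommGroup V] [Module ℂ V]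
          (ρ : Representation ℂ (ProjCliff (n + 1)) V), ρ.IsIrreducible →
          (∃ (W : Type u) (_ : AddCommGroup W) (_ : Module ℂ W)
            (ψ : Representation ℂ (InertiaQuot n) W),
            ψ.IsIrreducible ∧ Nonempty (ρ.Equiv (inducedKind σ' ψ))) ∨
          (∃ (W : Type u) (_ : AddCommGroup W) (_ : Module ℂ W)
            (ψ : Representation ℂ (Sp (n + 1)) W),
            ψ.IsIrreducible ∧ Nonempty (ρ.Equiv (inflatedKind e ψ)))) ∧
        (∀ (W₁ W₂ : Type u) [AddCommGroup W₁] [Module ℂ W₁] [AddCommGroup W₂] [Module ℂ W₂]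
          (ψ₁ : Representation ℂ (InertiaQuot n) W₁) (ψ₂ : Representation ℂ (InertiaQuot n) W₂),
          ψ₁.IsIrreducible → ψ₂.IsIrreducible →
          Nonempty ((inducedKind σ' ψ₁).Equiv (inducedKind σ' ψ₂)) → Nonempty (ψ₁.Equiv ψ₂)) ∧
        (∀ (W₁ W₂ : Type u) [AddCommGroup W₁] [Module ℂ W₁] [AddCommGroup W₂] [Module ℂ W₂]
          (ψ₁ : Representation ℂ (Sp (n + 1)) W₁) (ψ₂ : Representation ℂ (Sp (n + 1)) W₂),
          ψ₁.IsIrreducible → ψ₂.IsIrreducible →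
          Nonempty ((inflatedKind e ψ₁).Equiv (inflatedKind e ψ₂)) → Nonempty (ψ₁.Equiv ψ₂)) ∧
        (∀ (W₁ W₂ : Type u) [AddCommGroup W₁] [Module ℂ W₁] [AddCommGroup W₂] [Module ℂ W₂]
          (ψ₁ : Representation ℂ (InertiaQuot n) W₁) (ψ₂ : Representation ℂ (Sp (n + 1)) W₂),
          ψ₁.IsIrreducible → ψ₂.IsIrreducible →
          ¬ Nonempty ((inducedKind σ' ψ₁).Equiv (inflatedKind e ψ₂))) := by
  refine ⟨inertiaIN_eq_inertia n, ⟨_, isExtension_conjSign n⟩, quotientProjPauliEquiv (n + 1),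
    fun U x => ?_, fun σ' hσ => ⟨fun W _ _ ψ hψ => isIrreducible_inducedKind hσ hψ,
      fun W _ _ ψ hψ => isIrreducible_inflatedKind _ hψ, fun V _ _ ρ hρ => ?_,
      fun W₁ W₂ _ _ _ _ ψ₁ ψ₂ _ _ h => nonempty_equiv_of_inducedKind hσ h,
      fun W₁ W₂ _ _ _ _ ψ₁ ψ₂ _ _ h => nonempty_equiv_of_inflatedKind _ h,
      fun W₁ W₂ _ _ _ _ ψ₁ ψ₂ hψ₁ _ => ?_⟩⟩
  · rw [quotientProjPauliEquiv_mk, toSp_mulVec]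
    exact conj_weyl U x
  · by_cases h : ∀ g ∈ projPauli (n + 1), ∀ v, ρ g v = v
    · obtain ⟨ψ, hψ, e⟩ := exists_equiv_inflatedKind (quotientProjPauliEquiv (n + 1)) hρ h
      exact Or.inr ⟨V, _, _, ψ, hψ, e⟩
    · exact Or.inl (exists_equiv_inducedKind hρ hσ h)
  · rintro ⟨e⟩
    have := (Representation.isIrreducible_iff_forall_submodule.1 hψ₁).1
    obtain ⟨g, hg, v, hv⟩ := exists_inducedKind_apply_ne hσ ψ₁
    refine hv (e.toLinearEquiv.injective ?_)
    rw [Representation.Equiv.apply_apply, inflatedKind_apply_of_mem _ _ hg]
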